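/- **Setting.** Let $E$ be a measurable space and let $X=(X_t)_{t\ge 0}$ be a (conservative, time-homogeneous, progressively measurable) Markov process on $E$, with laws $\mathbb P_x$, $x\in E$, of the process started at $x$; for a measure $\mu$ on $E$ put $\mathbb P_\mu=\int \mathbb P_x\,\mu(dx)$. Let $\mathbb P_{\mu,[0,t]}$ be the law on $[0,t]$, i.e. on curves $[0,t]\to E$. A process is called reversible with respect to a $\sigma$-finite measure $m$ on $E$ if, for every $T\ge0$, its law on $[0,T]$ with initial distribution $m$ is invariant under the time reversal $\gamma\mapsto\gamma(T-\cdot)$ (in particular $m$ is stationary). Assume that $X$ is reversible with respect to the $\sigma$-finite measure $\pi$. Let $C$ be a uniformly closed linear space of bounded measurable functions on $E$, with the supremum norm, on which $(S_tf)(x)=\mathbb E_x f(X_t)$ is a strongly continuous semigroup. The generator $L$ of $X$ is $$ (Lf)(x)=\lim_{t\downarrow0}\frac{\mathbb E_xf(X_t)-f(x)}{t}, $$ with domain $\operatorname{dom}L$ the set of $f\in C$ for which this limit exists uniformly in $x$ and $Lf\in C$. The generator of any other process, with its domain in the same space $C$, is defined in the same way. Let $F:E\to\mathbb R$ be such that $e^{-F/2}\in\operatorname{dom}L$,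 and set $$ H(x,F)=e^{F(x)/2}\,(L e^{-F/2})(x),\qquad M_t=\exp\Big\{-\tfrac12F(X_t)+\tfrac12F(X_0)-\int_0^tH(X_s,F)\,ds\Big\}. $$ **Theorem.** Assume that $M$ is a martingale with respect to the filtration generated by $X$ under every $\mathbb P_x$, and let $X^F$ be the process whose law on $[0,t]$ is $M_t\,\mathbb P_{\mu,[0,t]}$ for each $t\ge 0$ and each initial distribution $\mu$. 1. The process $X^F$ is reversible with respect to the measure $e^{-F}\pi$. 2. Assume that $F$ is bounded and that $\operatorname{dom}L$ is closed under multiplication. Then the generator $L^F$ of $X^F$ satisfies $\operatorname{dom}L^F=\operatorname{dom}L$, and for every $\varphi\in\operatorname{dom}L$ $$ L^F\varphi=e^{F/2}L\big(e^{-F/2}\varphi\big)-e^{F/2}\varphi\,L e^{-F/2}. $$ -/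

import Mathlib

open MeasureTheory ProbabilityTheory Filter Topology
open scoped NNReal ENNReal

noncomputable section

namespace FlemingSheu

/-! ## Markov families -/

section Past

variable {E Ω : Type*} [MeasurableSpace E]

/-- The σ-algebra `σ(X_s : s ≤ t)` generated by the past of `X` up to time `t`. -/
abbrev past (X : ℝ≥0 → Ω → E) (t : ℝ≥0) : MeasurableSpace Ω :=
  ⨆ s : Set.Iic t, MeasurableSpace.comap (X s) inferInstance

end Past

/-- A conservative time-homogeneous Markov process with state space `E`: a process `X` on `Ω`
together with the laws `P x` of the process started at `x`.  The paths are only assumed to be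
progressively measurable, which is automatic for right-continuous paths in a metrizable space. -/
structure MarkovFamily (E Ω : Type*) [MeasurableSpace E] [MeasurableSpace Ω] where
  X : ℝ≥0 → Ω → E
  P : Kernel E Ω
  isMarkovKernel : IsMarkovKernel P
  measurable_X : ∀ t, Measurable (X t)
  progressive : ∀ t : ℝ≥0,
    Measurable[(inferInstance : MeasurableSpace (Set.Iic t)).prod (past X t)]
      (fun p : Set.Iic t × Ω => X p.1 p.2)
  start : ∀ x, ∀ᵐ ω ∂(P x), X 0 ω = x
  /-- `P_x(X_{s+t} ∈ A | σ(X_r : r ≤ s)) = P_{X_s}(X_t ∈ A)`. -/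
  markov : ∀ (x : E) (s t : ℝ≥0) (A : Set E), MeasurableSet A →
    (P x)[(X (s + t) ⁻¹' A).indicator (fun _ => (1 : ℝ)) | past X s]
      =ᵐ[P x] fun ω => (P (X s ω)).real (X t ⁻¹' A)

/-! ## Path laws, reversibility, semigroup and generator -/

/-- The laws of a process with values in `E`: `Λ T μ` is the law of `(X_s)_{0 ≤ s ≤ T}`, a measure
on the space of curves `[0,T] → E`, when the initial distribution is `μ`. -/
abbrev PathLaws (E : Type*) [MeasurableSpace E] : Type _ :=
  (T : ℝ≥0) → Measure E → Measure (Set.Iic T → E)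

section PathLaws

variable {E : Type*} [MeasurableSpace E]

/-- Time reversal `γ ↦ (s ↦ γ (T - s))` of curves on `[0,T]`. -/
def timeReversal (E : Type*) (T : ℝ≥0) (γ : Set.Iic T → E) : Set.Iic T → E :=
  fun s => γ ⟨T - s, Set.mem_Iic.2 tsub_le_self⟩

/-- The process with laws `Λ` is reversible with respect to `m`: on every window `[0,T]` its law
with initial distribution `m` is invariant under time reversal.  (Evaluating at time `0`, this
contains the stationarity of `m`.) -/
def IsReversible (Λ : PathLaws E) (m : Measure E) : Prop :=
  ∀ T, (Λ T m).map (timeReversal E T) = Λ T m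

/-- `(S_t f)(x) = 𝔼_x f(X_t)`. -/
def semigroup (Λ : PathLaws E) (t : ℝ≥0) (f : E → ℝ) (x : E) : ℝ :=
  ∫ γ, f (γ ⟨t, Set.mem_Iic.2 le_rfl⟩) ∂(Λ t (Measure.dirac x))

/-- `(S_t f - f) / t`. -/
def differenceQuotient (Λ : PathLaws E) (f : E → ℝ) (t : ℝ≥0) (x : E) : ℝ :=
  (semigroup Λ t f x - f x) / t

/-- The generator `(L f)(x) = lim_{t ↓ 0} (𝔼_x f(X_t) - f(x)) / t`; see `generatorDomain`. -/
def generator (Λ : PathLaws E) (f : E → ℝ) (x : E) : ℝ :=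
  limUnder (𝓝[>] (0 : ℝ≥0)) (fun t => differenceQuotient Λ f t x)

/-- The domain of the generator in the function space `C`, which carries the supremum norm: those
`f ∈ C` for which `(S_t f - f) / t` converges uniformly, as `t ↓ 0`, to an element of `C`. -/
def generatorDomain (C : Submodule ℝ (E → ℝ)) (Λ : PathLaws E) : Set (E → ℝ) :=
  {f | f ∈ C ∧ generator Λ f ∈ C ∧
    TendstoUniformly (differenceQuotient Λ f) (generator Λ f) (𝓝[>] (0 : ℝ≥0))}

/-- `C` is a Banach space of bounded measurable functions (with the supremum norm) on which the
process with laws `Λ` has a strongly continuous semigroup. -/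
structure IsSemigroupSpace (C : Submodule ℝ (E → ℝ)) (Λ : PathLaws E) : Prop where
  measurable : ∀ f ∈ C, Measurable f
  bounded : ∀ f ∈ C, ∃ K : ℝ, ∀ x, |f x| ≤ K
  uniformly_closed : ∀ g : E → ℝ, (∀ ε > 0, ∃ f ∈ C, ∀ x, |f x - g x| ≤ ε) → g ∈ C
  invariant : ∀ t, ∀ f ∈ C, semigroup Λ t f ∈ C
  strongly_continuous : ∀ f ∈ C,
    TendstoUniformly (fun t => semigroup Λ t f) f (𝓝[>] (0 : ℝ≥0))

end PathLaws

/-! ## The Markov family and its tilting -/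

namespace MarkovFamily

variable {E Ω : Type*} [MeasurableSpace E] [MeasurableSpace Ω] (𝒳 : MarkovFamily E Ω)

/-- The filtration generated by `X`. -/
def filtration : Filtration ℝ≥0 (inferInstance : MeasurableSpace Ω) where
  seq := past 𝒳.X
  mono' _ t hst := iSup_le fun r =>
    le_iSup (fun s : Set.Iic t => MeasurableSpace.comap (𝒳.X s) inferInstance)
      ⟨(r : ℝ≥0), le_trans r.2 hst⟩
  le' _ := iSup_le fun s => (𝒳.measurable_X s).comap_le

/-- The restriction `(X_s)_{0 ≤ s ≤ T}` of the path of `X` to `[0,T]`. -/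
def path (T : ℝ≥0) (ω : Ω) : Set.Iic T → E := fun s => 𝒳.X s ω

/-- The laws of `X`. -/
def laws : PathLaws E := fun T μ => (μ.bind 𝒳.P).map (𝒳.path T)

/-- The logarithmic transform `H(x,F) = e^{F(x)/2} (L e^{-F/2})(x)`. -/
def logTransform (F : E → ℝ) (x : E) : ℝ :=
  Real.exp (F x / 2) * generator 𝒳.laws (fun y => Real.exp (-F y / 2)) x

/-- `M_t = exp (-F(X_t)/2 + F(X_0)/2 - ∫_0^t H(X_s,F) ds)`. -/
def tiltMartingale (F : E → ℝ) (t : ℝ≥0) (ω : Ω) : ℝ :=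
  Real.exp (-F (𝒳.X t ω) / 2 + F (𝒳.X 0 ω) / 2
    - ∫ s in (0 : ℝ)..t, 𝒳.logTransform F (𝒳.X s.toNNReal ω))

/-- The laws of the tilted process `X^F`: on `[0,T]` the law of `X` is multiplied by `M_T`. -/
def tiltedLaws (F : E → ℝ) : PathLaws E := fun T μ =>
  ((μ.bind 𝒳.P).withDensity (fun ω => ENNReal.ofReal (𝒳.tiltMartingale F T ω))).map (𝒳.path T)

end MarkovFamily

end FlemingSheu

end

open MeasureTheory ProbabilityTheory Filter Topology
open scoped NNReal ENNReal BoundedContinuousFunction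

noncomputable section

/-! Reversibility. Starting from $e^{-F}\pi$ multiplies the path law by $e^{-F(X_0)}$, and together
with $M_T$ the density becomes $\exp\{-\tfrac12F(X_0)-\tfrac12F(X_T)-\int_0^TH(X_s)\,ds\}$, formally
symmetric under time reversal. The delicate term is the integral. The reversal of a path of $X$ need
not be a path of $X$, and on $E^{[0,T]}$ with the product σ-algebra the integral is not a priori
measurable. Progressive measurability makes it a measurable function $G$ of the path, determined
only on actual paths. With $R$ the reversal, $\int(G\circ R-G)^2=0$ under the path law: expand the
square and compute the cross term by Fubini on `Ω` and reversal at each fixed time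
(`occupation_comp_timeReversal_of_isFiniteMeasure`). A symmetric positive weight handles infinite
$\pi$, truncation handles unbounded $H$.

Generator. With $g=e^{-F/2}$, the difference quotient of $X^F$ at $f$ is $g^{-1}$ times the sum of
the quotient of $X$ at $gf$ and a Feynman-Kac term, which converges uniformly to $-Hgf$
(`tendstoUniformly_feynmanKac`). Hence $f\in\operatorname{dom}L^F$ iff $gf\in\operatorname{dom}L$,
with the stated formula. Since $\operatorname{dom}L$ is closed under products, the domains agree
once $g^{-1}\in\operatorname{dom}L$ (`inv_mem_generatorDomain`). This follows from a geometric
series in $f=1-g/c'$: second order Taylor bounds control the difference quotients of its tails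
through those of $f$ and $f^2$, and the generator is closed. Density of $\operatorname{dom}L$ makes
$C$ an algebra, so that $H$ and the products above lie in $C$. -/

namespace FlemingSheu

/-! ### Path space and time reversal. -/

section PathSpace

variable {E : Type*} [MeasurableSpace E]

theorem measurable_timeReversal (T : ℝ≥0) : Measurable (timeReversal E T) :=
  measurable_pi_lambda _ fun _ => measurable_pi_apply _

/-- A reversal invariant law stays so when multiplied by a reversal invariant density. -/
theorem map_timeReversal_withDensity {T : ℝ≥0} {ν : Measure (Set.Iic T → E)}
    (hν : ν.map (timeReversal E T) = ν) {G : (Set.Iic T → E) → ℝ≥0∞} (hG : Measurable G)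
    (h : (fun γ => G (timeReversal E T γ)) =ᵐ[ν] G) :
    (ν.withDensity G).map (timeReversal E T) = ν.withDensity G := by
  have hR := measurable_timeReversal (E := E) T
  ext s hs
  rw [Measure.map_apply hR hs, withDensity_apply _ (hR hs), withDensity_apply _ hs]
  calc ∫⁻ γ in timeReversal E T ⁻¹' s, G γ ∂ν
      = ∫⁻ γ in timeReversal E T ⁻¹' s, G (timeReversal E T γ) ∂ν :=
        lintegral_congr_ae (ae_restrict_of_ae (h.mono fun _ hγ => hγ.symm))
    _ = ∫⁻ γ in s, G γ ∂(ν.map (timeReversal E T)) := (setLIntegral_map hs hG hR).symm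
    _ = _ := by rw [hν]

/-- The real time `s`, clipped to the window `[0,T]`. -/
def clip (T : ℝ≥0) (s : ℝ) : Set.Iic T := ⟨min s.toNNReal T, Set.mem_Iic.2 (min_le_right _ _)⟩

theorem measurable_clip (T : ℝ≥0) : Measurable (clip T) :=
  Measurable.subtype_mk (measurable_real_toNNReal.min measurable_const)

theorem coe_clip {T : ℝ≥0} {s : ℝ} (hs : s ≤ T) : (clip T s : ℝ≥0) = s.toNNReal :=
  min_eq_left (Real.toNNReal_le_iff_le_coe.2 hs)

theorem timeReversal_clip {E : Type*} {T : ℝ≥0} {s : ℝ} (h0 : 0 ≤ s) (hs : s ≤ T) (γ : Set.Iic T → E) :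
    timeReversal E T γ (clip T s) = γ (clip T (T - s)) := by
  unfold timeReversal
  congr 1
  apply Subtype.ext
  change T - (clip T s : ℝ≥0) = clip T (T - s)
  rw [coe_clip hs, coe_clip (by linarith), NNReal.sub_def, Real.coe_toNNReal _ h0]

end PathSpace

/-! ### Measurability of occupation integrals. -/

theorem map_withDensity_comp {α β : Type*} [MeasurableSpace α] [MeasurableSpace β]
    (μ : Measure α) {f : α → β} (hf : Measurable f) {G : β → ℝ≥0∞} (hG : Measurable G) :
    (μ.withDensity (fun a => G (f a))).map f = (μ.map f).withDensity G := by
  ext s hs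
  rw [Measure.map_apply hf hs, withDensity_apply _ (hf hs), withDensity_apply _ hs,
    setLIntegral_map hs hG hf]

theorem measurable_comp_clip {E Ω : Type*} [MeasurableSpace E] [MeasurableSpace Ω] {T : ℝ≥0}
    {Y : Set.Iic T × Ω → E} (hY : Measurable Y) :
    Measurable fun p : ℝ × Ω => Y (clip T p.1, p.2) :=
  hY.comp (((measurable_clip T).comp measurable_fst).prodMk measurable_snd)

theorem measurable_lintegral_clip {E Ω : Type*} [MeasurableSpace E] [MeasurableSpace Ω]
    {T : ℝ≥0} {Y : Set.Iic T × Ω → E} (hY : Measurable Y) {h : E → ℝ≥0∞} (hh : Measurable h) :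
    Measurable fun ω => ∫⁻ s in Set.Ioc (0 : ℝ) T, h (Y (clip T s, ω)) :=
  Measurable.lintegral_prod_left' (hh.comp (measurable_comp_clip hY))

/-- The Bochner integral of a function, in terms of the integrals of its positive and of its
negative part. -/
def partsIntegral (p : ℝ≥0∞ × ℝ≥0∞) : ℝ :=
  if p.1 ≠ ⊤ ∧ p.2 ≠ ⊤ then p.1.toReal - p.2.toReal else 0

theorem measurable_partsIntegral : Measurable partsIntegral := by
  refine Measurable.ite ?_ (by fun_prop) measurable_const
  exact (measurable_fst (measurableSet_singleton ⊤).compl).inter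
    (measurable_snd (measurableSet_singleton ⊤).compl)

/-- Integrability along paths is not known when $F$ is unbounded. The value 0 of `partsIntegral`
when either part is infinite matches the default value of the Bochner integral, so reversal
invariance of the two parts passes to the integral in every case. -/
theorem integral_eq_partsIntegral {α : Type*} [MeasurableSpace α] {μ : Measure α} {f : α → ℝ}
    (hf : AEStronglyMeasurable f μ) :
    ∫ a, f a ∂μ =
      partsIntegral (∫⁻ a, ENNReal.ofReal (f a) ∂μ, ∫⁻ a, ENNReal.ofReal (-f a) ∂μ) := by
  have hnorm : ∫⁻ a, ‖f a‖ₑ ∂μ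
      = ∫⁻ a, ENNReal.ofReal (f a) ∂μ + ∫⁻ a, ENNReal.ofReal (-f a) ∂μ := by
    rw [← lintegral_add_left' hf.aemeasurable.ennreal_ofReal]
    refine lintegral_congr fun a => ?_
    rw [Real.enorm_eq_ofReal_abs]
    rcases le_total 0 (f a) with h | h
    · rw [abs_of_nonneg h, ENNReal.ofReal_of_nonpos (neg_nonpos.2 h), add_zero]
    · rw [abs_of_nonpos h, ENNReal.ofReal_of_nonpos h, zero_add]
  by_cases hi : Integrable f μ
  · have hfin : ∫⁻ a, ‖f a‖ₑ ∂μ ≠ ⊤ := hi.hasFiniteIntegral.ne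
    rw [hnorm, ENNReal.add_ne_top] at hfin
    rw [integral_eq_lintegral_pos_part_sub_lintegral_neg_part hi, partsIntegral, if_pos hfin]
  · rw [integral_undef hi, partsIntegral, if_neg]
    intro hfin
    refine hi ⟨hf, ?_⟩
    rw [HasFiniteIntegral, hnorm]
    exact ENNReal.add_lt_top.2 ⟨hfin.1.lt_top, hfin.2.lt_top⟩

/-! ### Reversal invariance of occupation integrals and of the tilted laws. -/

namespace MarkovFamily

variable {E Ω : Type*} [MeasurableSpace E] [MeasurableSpace Ω] (𝒳 : MarkovFamily E Ω)

theorem measurable_path (T : ℝ≥0) : Measurable (𝒳.path T) :=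
  measurable_pi_lambda _ fun s => 𝒳.measurable_X s

theorem past_eq_comap_path (T : ℝ≥0) :
    past 𝒳.X T = MeasurableSpace.pi.comap (𝒳.path T) := by
  simp only [past, MeasurableSpace.pi, MeasurableSpace.comap_iSup, MeasurableSpace.comap_comp]
  rfl

theorem past_le (T : ℝ≥0) : past 𝒳.X T ≤ (inferInstance : MeasurableSpace Ω) :=
  𝒳.filtration.le T

theorem measurable_path_clip (T : ℝ≥0) :
    Measurable (fun p : ℝ × Ω => 𝒳.path T p.2 (clip T p.1)) :=
  measurable_comp_clip (Y := fun p : Set.Iic T × Ω => 𝒳.X p.1 p.2)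
    ((𝒳.progressive T).mono
      (sup_le_sup le_rfl (MeasurableSpace.comap_mono (𝒳.past_le T))) le_rfl)

theorem path_clip {T : ℝ≥0} {s : ℝ} (hs : s ≤ T) (ω : Ω) :
    𝒳.path T ω (clip T s) = 𝒳.X s.toNNReal ω := by
  rw [path, coe_clip hs]

/-- Occupation integrals are functions of the path. -/
theorem exists_lintegral_eq_comp_path (T : ℝ≥0) {h : E → ℝ≥0∞} (hh : Measurable h) :
    ∃ G : (Set.Iic T → E) → ℝ≥0∞, Measurable G ∧
      ∀ ω, G (𝒳.path T ω) = ∫⁻ s in Set.Ioc (0 : ℝ) T, h (𝒳.path T ω (clip T s)) := by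
  -- Measurability with respect to the past, not merely the ambient σ-algebra, is what lets the
  -- integral factor through the path.
  have key : Measurable[past 𝒳.X T]
      (fun ω => ∫⁻ s in Set.Ioc (0 : ℝ) T, h (𝒳.path T ω (clip T s))) :=
    @measurable_lintegral_clip E Ω _ (past 𝒳.X T) T _ (𝒳.progressive T) h hh
  rw [past_eq_comap_path] at key
  obtain ⟨G, hG, hGe⟩ := key.exists_eq_measurable_comp
  exact ⟨G, hG, fun ω => (congrFun hGe ω).symm⟩

/-- Fubini is carried out on `Ω`, where the process is jointly measurable in time and sample point;
evaluation on the product path space need not be. Only the values of `G` on actual paths enter. -/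
theorem integral_occupation_mul (Q : Measure Ω) [IsFiniteMeasure Q] {T : ℝ≥0} {h : E → ℝ}
    (hh : Measurable h) {B : ℝ} (hB : ∀ x, |h x| ≤ B) {G Z : (Set.Iic T → E) → ℝ}
    (hG : Measurable G)
    (hGp : ∀ ω, G (𝒳.path T ω) = ∫ s in (0 : ℝ)..T, h (𝒳.path T ω (clip T s)))
    (hZ : Measurable Z) {K : ℝ} (hK : ∀ γ, |Z γ| ≤ K) :
    ∫ γ, G γ * Z γ ∂(Q.map (𝒳.path T)) =
      ∫ s in (0 : ℝ)..T, ∫ γ, h (γ (clip T s)) * Z γ ∂(Q.map (𝒳.path T)) := by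
  have hp := 𝒳.measurable_path T
  have hmeas : ∀ s, Measurable fun γ : Set.Iic T → E => h (γ (clip T s)) * Z γ := fun s =>
    (hh.comp (measurable_pi_apply _)).mul hZ
  rw [integral_map hp.aemeasurable (f := fun γ => G γ * Z γ) (hG.mul hZ).aestronglyMeasurable]
  simp_rw [fun s => integral_map hp.aemeasurable (hmeas s).aestronglyMeasurable (μ := Q), hGp]
  simp_rw [← intervalIntegral.integral_mul_const]
  symm
  apply intervalIntegral_integral_swap
  rw [Set.uIoc_of_le T.coe_nonneg]
  refine Integrable.of_bound (C := B * K) ?_ (ae_of_all _ fun p => ?_)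
  · exact ((hh.comp (𝒳.measurable_path_clip T)).mul
      (hZ.comp (hp.comp measurable_snd))).aestronglyMeasurable
  · have h0 : 0 ≤ B := (abs_nonneg _).trans (hB (𝒳.path T p.2 (clip T p.1)))
    simp only [Function.uncurry, Real.norm_eq_abs, abs_mul]
    exact mul_le_mul (hB _) (hK _) (abs_nonneg _) h0

/-- For a finite reversal invariant path law, bounded occupation integrals are reversal
invariant. -/
theorem occupation_comp_timeReversal_of_isFiniteMeasure (Q : Measure Ω) [IsFiniteMeasure Q]
    {T : ℝ≥0} (hQ : (Q.map (𝒳.path T)).map (timeReversal E T) = Q.map (𝒳.path T)) {h : E → ℝ}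
    (hh : Measurable h) {B : ℝ} (hB : ∀ x, |h x| ≤ B) {G : (Set.Iic T → E) → ℝ}
    (hG : Measurable G)
    (hGp : ∀ ω, G (𝒳.path T ω) = ∫ s in (0 : ℝ)..T, h (𝒳.path T ω (clip T s)))
    {K : ℝ} (hK : ∀ γ, |G γ| ≤ K) :
    (fun γ => G (timeReversal E T γ)) =ᵐ[Q.map (𝒳.path T)] G := by
  set ν := Q.map (𝒳.path T) with hν
  set R := timeReversal E T with hRdef
  have hR : Measurable R := measurable_timeReversal T
  have hGR : Measurable fun γ => G (R γ) := hG.comp hR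
  have hinv : ∀ f : (Set.Iic T → E) → ℝ, Measurable f → ∫ γ, f (R γ) ∂ν = ∫ γ, f γ ∂ν := by
    intro f hf
    conv_rhs => rw [← hQ]
    rw [integral_map hR.aemeasurable hf.aestronglyMeasurable]
  -- After Fubini, invariance at each fixed $s$ turns $h(\gamma_s)\,G(R\gamma)$ into
  -- $h(\gamma_{T-s})\,G(\gamma)$; substituting $s\mapsto T-s$ and undoing Fubini gives $\int G^2$.
  have hcross : ∫ γ, G γ * G (R γ) ∂ν = ∫ γ, G γ * G γ ∂ν := by
    rw [𝒳.integral_occupation_mul Q hh hB hG hGp hGR (fun γ => hK _),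
      𝒳.integral_occupation_mul Q hh hB hG hGp hG hK]
    have h1 : ∫ s in (0 : ℝ)..T, ∫ γ, h (γ (clip T s)) * G (R γ) ∂ν
        = ∫ s in (0 : ℝ)..T, ∫ γ, h (γ (clip T (T - s))) * G γ ∂ν := by
      refine intervalIntegral.integral_congr fun s hs => ?_
      rw [Set.uIcc_of_le T.coe_nonneg] at hs
      have h0 : (0 : ℝ) ≤ T - s := sub_nonneg.2 hs.2
      have h2 : (T : ℝ) - s ≤ T := sub_le_self _ hs.1
      rw [← hinv (fun γ => h (γ (clip T (T - s))) * G γ)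
        ((hh.comp (measurable_pi_apply _)).mul hG)]
      refine integral_congr_ae (ae_of_all _ fun γ => ?_)
      simp only [hRdef]
      rw [timeReversal_clip h0 h2, sub_sub_cancel]
    rw [h1, intervalIntegral.integral_comp_sub_left
      (fun s => ∫ γ, h (γ (clip T s)) * G γ ∂ν), sub_self, sub_zero]
  have hb : ∀ f : (Set.Iic T → E) → ℝ, Measurable f → (∀ γ, |f γ| ≤ K * K) → Integrable f ν :=
    fun f hf hfb => Integrable.of_bound hf.aestronglyMeasurable (K * K) (ae_of_all _ hfb)
  have hmul : ∀ γ γ', |G γ * G γ'| ≤ K * K := fun γ γ' => by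
    rw [abs_mul]
    exact mul_le_mul (hK _) (hK _) (abs_nonneg _) ((abs_nonneg _).trans (hK γ))
  have i1 := hb _ (hG.mul hG) fun γ => hmul _ _
  have i2 := hb _ (hGR.mul hGR) fun γ => hmul _ _
  have i3 := hb _ (hG.mul hGR) fun γ => hmul _ _
  have he : (fun γ => (G (R γ) - G γ) ^ 2)
      = ((fun γ => G (R γ)) * (fun γ => G (R γ)) + G * G) - (2 : ℝ) • (G * fun γ => G (R γ)) := by
    funext γ
    simp only [Pi.mul_apply, Pi.sub_apply, Pi.add_apply, Pi.smul_apply, smul_eq_mul]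
    ring
  have hsq : ∫ γ, (G (R γ) - G γ) ^ 2 ∂ν = 0 := by
    rw [he, integral_sub' (i2.add i1) (i3.smul (2 : ℝ)), integral_add' i2 i1]
    have := hinv _ (hG.mul hG)
    simp only [Pi.mul_apply, Pi.smul_apply, smul_eq_mul] at this ⊢
    rw [integral_const_mul, hcross, this]; ring
  rw [integral_eq_zero_iff_of_nonneg (fun γ => sq_nonneg _)] at hsq
  · filter_upwards [hsq] with γ hγ
    exact sub_eq_zero.1 (pow_eq_zero_iff two_ne_zero |>.1 hγ)
  · rw [he]
    exact (i2.add i1).sub (i3.smul (2 : ℝ))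

theorem measurable_P : Measurable (𝒳.P : E → Measure Ω) := 𝒳.P.measurable

/-- Under `P x` the path starts at `x` almost surely, so a density of the initial distribution can
be read off from `X 0`. -/
theorem bind_withDensity (m : Measure E) {d : E → ℝ≥0∞} (hd : Measurable d) :
    (m.withDensity d).bind 𝒳.P = (m.bind 𝒳.P).withDensity (fun ω => d (𝒳.X 0 ω)) := by
  have hP := 𝒳.measurable_P
  ext s hs
  rw [Measure.bind_apply hs hP.aemeasurable, withDensity_apply _ hs,
    lintegral_withDensity_eq_lintegral_mul _ hd (Measure.measurable_measure.1 hP s hs),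
    ← lintegral_indicator hs, Measure.lintegral_bind hP.aemeasurable
      (f := s.indicator fun ω => d (𝒳.X 0 ω))
      ((hd.comp (𝒳.measurable_X 0)).indicator hs).aemeasurable]
  refine lintegral_congr fun x => ?_
  rw [lintegral_indicator hs]
  have : ∫⁻ ω in s, d (𝒳.X 0 ω) ∂(𝒳.P x) = ∫⁻ _ in s, d x ∂(𝒳.P x) :=
    lintegral_congr_ae (ae_restrict_of_ae ((𝒳.start x).mono fun ω hω => by simp only [hω]))
  rw [this]
  simp

theorem lintegral_start_bind (m : Measure E) {d : E → ℝ≥0∞} (hd : Measurable d) :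
    ∫⁻ ω, d (𝒳.X 0 ω) ∂(m.bind 𝒳.P) = ∫⁻ x, d x ∂m := by
  have := 𝒳.isMarkovKernel
  rw [← setLIntegral_univ, ← withDensity_apply _ MeasurableSet.univ, ← 𝒳.bind_withDensity m hd,
    Measure.bind_apply MeasurableSet.univ 𝒳.measurable_P.aemeasurable]
  simp

/-- For a process that is reversible with respect to a σ-finite measure, bounded occupation
integrals are reversal invariant. -/
theorem occupation_comp_timeReversal (m : Measure E) [SigmaFinite m] {T : ℝ≥0}
    (hrev : (𝒳.laws T m).map (timeReversal E T) = 𝒳.laws T m) {h : E → ℝ}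
    (hh : Measurable h) {B : ℝ} (hB : ∀ x, |h x| ≤ B) {G : (Set.Iic T → E) → ℝ}
    (hG : Measurable G)
    (hGp : ∀ ω, G (𝒳.path T ω) = ∫ s in (0 : ℝ)..T, h (𝒳.path T ω (clip T s)))
    {K : ℝ} (hK : ∀ γ, |G γ| ≤ K) :
    (fun γ => G (timeReversal E T γ)) =ᵐ[𝒳.laws T m] G := by
  obtain ⟨w, wpos, wmeas, wint⟩ := exists_pos_lintegral_lt_of_sigmaFinite m one_ne_zero
  let v : E → ℝ≥0∞ := fun x => min (w x) 1
  have hv : Measurable v := wmeas.coe_nnreal_ennreal.min measurable_const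
  have hv0 : ∀ x, v x ≠ 0 := fun x =>
    (lt_min (ENNReal.coe_pos.2 (wpos x)) one_pos).ne'
  -- Weighting both endpoints keeps the law reversal invariant; as `v ≤ 1`, the factor at time 0
  -- alone makes the mass finite.
  let W : (Set.Iic T → E) → ℝ≥0∞ := fun γ => v (γ ⟨0, Set.mem_Iic.2 zero_le⟩) * v (γ ⟨T, Set.mem_Iic.2 le_rfl⟩)
  have hW : Measurable W := (hv.comp (measurable_pi_apply _)).mul (hv.comp (measurable_pi_apply _))
  have hWR : ∀ γ, W (timeReversal E T γ) = W γ := fun γ => by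
    simp only [W, timeReversal]
    simp only [tsub_zero, tsub_self]
    rw [mul_comm]
  have hp := 𝒳.measurable_path T
  let Q := (m.bind 𝒳.P).withDensity fun ω => W (𝒳.path T ω)
  have hQ : Q.map (𝒳.path T) = (𝒳.laws T m).withDensity W := map_withDensity_comp _ hp hW
  have hfin : IsFiniteMeasure Q := by
    refine isFiniteMeasure_withDensity (ne_of_lt ?_)
    calc ∫⁻ ω, W (𝒳.path T ω) ∂(m.bind 𝒳.P) ≤ ∫⁻ ω, v (𝒳.X 0 ω) ∂(m.bind 𝒳.P) :=
          lintegral_mono fun ω => mul_le_of_le_one_right' (min_le_right _ _)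
      _ = ∫⁻ x, v x ∂m := 𝒳.lintegral_start_bind m hv
      _ ≤ ∫⁻ x, w x ∂m := lintegral_mono fun x => min_le_left _ _
      _ < ⊤ := wint.trans ENNReal.one_lt_top
  have := 𝒳.occupation_comp_timeReversal_of_isFiniteMeasure Q
    (by rw [hQ]; exact map_timeReversal_withDensity hrev hW (ae_of_all _ hWR)) hh hB hG hGp hK
  rw [hQ] at this
  -- The weight vanishes nowhere, so the weighted and the original path law have the same null sets.
  exact (withDensity_absolutelyContinuous' hW.aemeasurable
    (ae_of_all _ fun γ => mul_ne_zero (hv0 _) (hv0 _))).ae_le this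

theorem exists_occupation_comp_timeReversal (m : Measure E) [SigmaFinite m] {T : ℝ≥0}
    (hrev : (𝒳.laws T m).map (timeReversal E T) = 𝒳.laws T m) {h : E → ℝ≥0∞}
    (hh : Measurable h) :
    ∃ G : (Set.Iic T → E) → ℝ≥0∞, Measurable G ∧
      (∀ ω, G (𝒳.path T ω) = ∫⁻ s in Set.Ioc (0 : ℝ) T, h (𝒳.path T ω (clip T s))) ∧
      (fun γ => G (timeReversal E T γ)) =ᵐ[𝒳.laws T m] G := by
  let k : ℕ → E → ℝ≥0∞ := fun n x => min (h x) n
  have hk : ∀ n, Measurable (k n) := fun n => hh.min measurable_const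
  have hkn : ∀ n x, k n x ≤ n := fun n x => min_le_right _ _
  have hktop : ∀ n x, k n x ≠ ⊤ := fun n x => ((hkn n x).trans_lt (ENNReal.natCast_lt_top n)).ne
  choose G hG hGp using fun n => 𝒳.exists_lintegral_eq_comp_path T (hk n)
  have hGb : ∀ n ω, G n (𝒳.path T ω) ≤ n * T := fun n ω => by
    rw [hGp]
    calc ∫⁻ s in Set.Ioc (0 : ℝ) T, k n (𝒳.path T ω (clip T s))
        ≤ ∫⁻ _ in Set.Ioc (0 : ℝ) T, (n : ℝ≥0∞) := lintegral_mono fun s => hkn _ _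
      _ = n * T := by simp
  -- `G n` is bounded by `n * T` only on actual paths; the second truncation bounds it on all
  -- curves.
  let G' : ℕ → (Set.Iic T → E) → ℝ≥0∞ := fun n γ => min (G n γ) (n * T)
  have hG' : ∀ n, Measurable (G' n) := fun n => (hG n).min measurable_const
  have hG'p : ∀ n ω, G' n (𝒳.path T ω) = G n (𝒳.path T ω) := fun n ω => min_eq_left (hGb n ω)
  have hnT : ∀ n : ℕ, (n : ℝ≥0∞) * T ≠ ⊤ := fun n =>
    ENNReal.mul_ne_top (ENNReal.natCast_ne_top n) ENNReal.coe_ne_top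
  have hG't : ∀ n γ, G' n γ ≠ ⊤ := fun n γ => ((min_le_right _ _).trans_lt (hnT n).lt_top).ne
  have hinv : ∀ n, (fun γ => (G' n (timeReversal E T γ)).toReal) =ᵐ[𝒳.laws T m]
      fun γ => (G' n γ).toReal := by
    intro n
    refine 𝒳.occupation_comp_timeReversal m hrev (h := fun x => (k n x).toReal)
      (hk n).ennreal_toReal (B := n) (fun x => ?_) (hG' n).ennreal_toReal (fun ω => ?_)
      (K := (n * T : ℝ≥0∞).toReal) (fun γ => ?_)
    · rw [abs_of_nonneg ENNReal.toReal_nonneg]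
      exact ENNReal.toReal_le_of_le_ofReal n.cast_nonneg (by simpa using hkn n x)
    · rw [hG'p, hGp, intervalIntegral.integral_of_le T.coe_nonneg, integral_toReal]
      · exact ((hk n).comp ((𝒳.measurable_path_clip T).comp
          measurable_prodMk_right)).aemeasurable
      · exact ae_of_all _ fun s => (hktop _ _).lt_top
    · rw [abs_of_nonneg ENNReal.toReal_nonneg]
      exact ENNReal.toReal_mono (hnT n) (min_le_right _ _)
  refine ⟨fun γ => ⨆ n, G' n γ, Measurable.iSup hG', fun ω => ?_, ?_⟩
  · simp_rw [hG'p, hGp]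
    rw [← lintegral_iSup]
    · refine lintegral_congr fun s => ?_
      simp only [k]
      rw [← inf_iSup_eq, ENNReal.iSup_natCast, inf_top_eq]
    · exact fun n => (hk n).comp ((𝒳.measurable_path_clip T).comp measurable_prodMk_right)
    · exact fun i j hij s => min_le_min_left _ (Nat.cast_le.2 hij)
  · filter_upwards [ae_all_iff.2 hinv] with γ hγ
    exact iSup_congr fun n => (ENNReal.toReal_eq_toReal_iff' (hG't _ _) (hG't _ _)).1 (hγ n)

theorem intervalIntegral_eq_partsIntegral (T : ℝ≥0) {h : E → ℝ} (hh : Measurable h) (ω : Ω) :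
    ∫ s in (0 : ℝ)..T, h (𝒳.X s.toNNReal ω) = partsIntegral
      (∫⁻ s in Set.Ioc (0 : ℝ) T, ENNReal.ofReal (h (𝒳.path T ω (clip T s))),
        ∫⁻ s in Set.Ioc (0 : ℝ) T, ENNReal.ofReal (-h (𝒳.path T ω (clip T s)))) := by
  have h1 : ∫ s in (0 : ℝ)..T, h (𝒳.X s.toNNReal ω)
      = ∫ s in Set.Ioc (0 : ℝ) T, h (𝒳.path T ω (clip T s)) := by
    rw [intervalIntegral.integral_of_le T.coe_nonneg]
    exact setIntegral_congr_fun measurableSet_Ioc fun s hs => by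
      simp only [𝒳.path_clip hs.2]
  rw [h1]
  exact integral_eq_partsIntegral (hh.comp ((𝒳.measurable_path_clip T).comp
    measurable_prodMk_right)).aestronglyMeasurable

/-- The initial density changes the exponent $-\tfrac12F(X_T)+\tfrac12F(X_0)$ of $M_T$ into
$-\tfrac12F(X_T)-\tfrac12F(X_0)$, which is symmetric in the endpoints. The positive and negative
parts of the time integral are reversed separately. -/
theorem isReversible_tiltedLaws (m : Measure E) [SigmaFinite m] (hrev : IsReversible 𝒳.laws m)
    {F : E → ℝ} (hF : Measurable F) (hH : Measurable (𝒳.logTransform F)) :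
    IsReversible (𝒳.tiltedLaws F) (m.withDensity fun x => ENNReal.ofReal (Real.exp (-F x))) := by
  intro T
  obtain ⟨A, hA, hAp, hAR⟩ := 𝒳.exists_occupation_comp_timeReversal m (hrev T)
    hH.ennreal_ofReal
  obtain ⟨B, hB, hBp, hBR⟩ := 𝒳.exists_occupation_comp_timeReversal m (hrev T)
    hH.neg.ennreal_ofReal
  let J : (Set.Iic T → E) → ℝ := fun γ => partsIntegral (A γ, B γ)
  have hJ : Measurable J := measurable_partsIntegral.comp (hA.prodMk hB)
  have hJp : ∀ ω, J (𝒳.path T ω) = ∫ s in (0 : ℝ)..T, 𝒳.logTransform F (𝒳.X s.toNNReal ω) :=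
    fun ω => by
      rw [𝒳.intervalIntegral_eq_partsIntegral T hH]
      simp only [J, hAp, hBp, Pi.neg_apply]
  let p0 : Set.Iic T := ⟨0, Set.mem_Iic.2 zero_le⟩
  let pT : Set.Iic T := ⟨T, Set.mem_Iic.2 le_rfl⟩
  have hFe : ∀ p : Set.Iic T, Measurable fun γ : Set.Iic T → E => F (γ p) := fun p =>
    hF.comp (measurable_pi_apply p)
  let M : (Set.Iic T → E) → ℝ≥0∞ := fun γ =>
    ENNReal.ofReal (Real.exp (-F (γ pT) / 2 + F (γ p0) / 2 - J γ))
  have hM : Measurable M :=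
    (Real.measurable_exp.comp ((((hFe pT).neg.div_const 2).add
      ((hFe p0).div_const 2)).sub hJ)).ennreal_ofReal
  have hMp : ∀ ω, ENNReal.ofReal (𝒳.tiltMartingale F T ω) = M (𝒳.path T ω) := fun ω => by
    simp only [M, tiltMartingale, hJp]
    rfl
  let D : (Set.Iic T → E) → ℝ≥0∞ := fun γ => ENNReal.ofReal (Real.exp (-F (γ p0)))
  have hD : Measurable D := (Real.measurable_exp.comp (hFe p0).neg).ennreal_ofReal
  have htilt : 𝒳.tiltedLaws F T (m.withDensity fun x => ENNReal.ofReal (Real.exp (-F x)))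
      = (𝒳.laws T m).withDensity (D * M) := by
    have hp := 𝒳.measurable_path T
    have h0 : (m.withDensity fun x => ENNReal.ofReal (Real.exp (-F x))).bind 𝒳.P
        = (m.bind 𝒳.P).withDensity fun ω => D (𝒳.path T ω) :=
      𝒳.bind_withDensity m (Real.measurable_exp.comp hF.neg).ennreal_ofReal
    simp only [tiltedLaws, hMp]
    rw [h0, map_withDensity_comp _ hp hM, map_withDensity_comp _ hp hD, withDensity_mul _ hD hM]
    rfl
  rw [htilt]
  refine map_timeReversal_withDensity (hrev T) (hD.mul hM) ?_
  filter_upwards [hAR, hBR] with γ hγA hγB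
  have hRJ : J (timeReversal E T γ) = J γ := by simp only [J, hγA, hγB]
  have hR0 : timeReversal E T γ p0 = γ pT := by simp [timeReversal, p0, pT]
  have hRT : timeReversal E T γ pT = γ p0 := by simp [timeReversal, p0, pT]
  simp only [Pi.mul_apply, D, M, hRJ, hR0, hRT]
  rw [← ENNReal.ofReal_mul (Real.exp_pos _).le, ← ENNReal.ofReal_mul (Real.exp_pos _).le,
    ← Real.exp_add, ← Real.exp_add]
  congr 2
  ring

end MarkovFamily

/-! ### The semigroup on `C` and density of the generator domain. -/

/-- The domain of the generator of a strongly continuous contraction semigroup is dense. -/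
theorem exists_near_hasGenerator {Y : Type*} [NormedAddCommGroup Y] [NormedSpace ℝ Y]
    [CompleteSpace Y] (S : ℝ≥0 → Y →L[ℝ] Y) (hadd : ∀ s t y, S (s + t) y = S s (S t y))
    (hcontr : ∀ t y, ‖S t y‖ ≤ ‖y‖)
    (hcont : ∀ y, Tendsto (fun t => S t y) (𝓝[>] 0) (𝓝 y)) (y : Y) {ε : ℝ} (hε : 0 < ε) :
    ∃ z w, ‖z - y‖ < ε ∧
      Tendsto (fun t : ℝ≥0 => (t : ℝ)⁻¹ • (S t z - z)) (𝓝[>] 0) (𝓝 w) := by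
  -- That `S 0` is the identity is not assumed: $S_tS_0y=S_ty$ tends both to $S_0y$ and to $y$.
  have hzero : ∀ y, S 0 y = y := fun y => by
    have h := hcont (S 0 y)
    simp_rw [← hadd, add_zero] at h
    exact tendsto_nhds_unique h (hcont y)
  have hcont0 : Tendsto (fun t => S t y) (𝓝 0) (𝓝 y) := by
    have : (𝓝 (0 : ℝ≥0)) = pure 0 ⊔ 𝓝[>] 0 := by
      rw [← nhdsWithin_singleton, ← nhdsWithin_union]
      have : ({0} ∪ Set.Ioi 0 : Set ℝ≥0) = Set.univ := by
        ext t
        simp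
      rw [this, nhdsWithin_univ]
    rw [this]
    refine Tendsto.sup ?_ (hcont y)
    rw [tendsto_pure_left]
    intro s hs
    rw [hzero]
    exact mem_of_mem_nhds hs
  have hdist' : ∀ s r, s ≤ r → dist (S s y) (S r y) ≤ ‖S (nndist s r) y - y‖ := by
    intro s r hsr
    have hr : r = s + nndist s r := by
      rw [NNReal.nndist_eq, tsub_eq_zero_of_le hsr, max_eq_right zero_le, add_tsub_cancel_of_le hsr]
    rw [dist_comm, dist_eq_norm]
    conv_lhs => rw [hr, hadd, ← map_sub]
    exact hcontr _ _
  have hdist : ∀ s r, dist (S s y) (S r y) ≤ ‖S (nndist s r) y - y‖ := by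
    intro s r
    rcases le_total s r with h | h
    · exact hdist' s r h
    · rw [dist_comm, nndist_comm]
      exact hdist' r s h
  have hcS : Continuous fun s => S s y := by
    rw [continuous_iff_continuousAt]
    intro r
    rw [ContinuousAt, tendsto_iff_dist_tendsto_zero]
    refine squeeze_zero (fun _ => dist_nonneg) (fun s => hdist s r) ?_
    have h1 : Tendsto (fun s => nndist s r) (𝓝 r) (𝓝 0) := by
      have : Continuous fun s : ℝ≥0 => nndist s r := by fun_prop
      simpa using this.tendsto r
    simpa using ((hcont0.comp h1).sub_const y).norm
  let c : ℝ → Y := fun s => S s.toNNReal y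
  have hc : Continuous c := hcS.comp continuous_real_toNNReal
  have hc0 : c 0 = y := by simp [c, hzero]
  have hderiv : ∀ a b : ℝ, HasDerivAt (fun u => ∫ s in a..u, c s) (c b) b := fun a b =>
    intervalIntegral.integral_hasDerivAt_right (hc.intervalIntegrable _ _)
      (hc.stronglyMeasurableAtFilter _ _) hc.continuousAt
  have hright : Tendsto (fun t : ℝ≥0 => (t : ℝ)) (𝓝[>] 0) (𝓝[>] 0) := by
    refine tendsto_nhdsWithin_iff.2 ⟨?_, ?_⟩
    · simpa using (NNReal.continuous_coe.tendsto 0).mono_left nhdsWithin_le_nhds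
    · exact eventually_mem_nhdsWithin.mono fun t ht => NNReal.coe_pos.2 ht
  have hslope : ∀ b : ℝ, Tendsto (fun t : ℝ≥0 => (t : ℝ)⁻¹ • ∫ s in b..b + t, c s) (𝓝[>] 0)
      (𝓝 (c b)) := by
    intro b
    have := (hderiv b b).tendsto_slope_zero_right.comp hright
    simpa [Function.comp_def] using this
  have h0 := hslope 0
  rw [hc0] at h0
  simp only [zero_add] at h0
  obtain ⟨t, htpos, ht⟩ : ∃ t : ℝ≥0, 0 < t ∧ ‖(t : ℝ)⁻¹ • (∫ s in (0 : ℝ)..t, c s) - y‖ < ε := by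
    have h1 := (h0.sub_const y).norm
    rw [sub_self, norm_zero] at h1
    obtain ⟨t, h2, h3⟩ := ((h1.eventually (gt_mem_nhds hε)).and eventually_mem_nhdsWithin).exists
    exact ⟨t, h3, h2⟩
  -- The approximant is the average $t^{-1}\int_0^tS_sy\,ds$. Applying $S_r$ shifts the interval of
  -- integration, so only the two end pieces survive in the difference, and the generator gives
  -- $(S_ty-y)/t$.
  refine ⟨_, (t : ℝ)⁻¹ • (c t - c 0), ht, ?_⟩
  have hshift : ∀ r : ℝ≥0, S r (∫ s in (0 : ℝ)..t, c s) = ∫ s in (r : ℝ)..t + r, c s := by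
    intro r
    rw [← ContinuousLinearMap.intervalIntegral_comp_comm _ (hc.intervalIntegrable _ _)]
    have h1 := intervalIntegral.integral_comp_add_right (a := 0) (b := t) c (r : ℝ)
    rw [zero_add] at h1
    rw [← h1]
    refine intervalIntegral.integral_congr fun s hs => ?_
    rw [Set.uIcc_of_le t.coe_nonneg] at hs
    simp only [c]
    rw [← hadd, Real.toNNReal_add hs.1 r.coe_nonneg, Real.toNNReal_coe, add_comm]
  have hi : ∀ a b : ℝ, IntervalIntegrable c volume a b := fun a b => hc.intervalIntegrable a b
  have hfinal := ((hslope t).sub (hslope 0)).const_smul (t : ℝ)⁻¹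
  refine hfinal.congr fun r => ?_
  rw [map_smul, hshift, ← smul_sub, ← smul_sub, smul_comm]
  congr 2
  rw [zero_add, intervalIntegral.integral_interval_sub_interval_comm' (hi r _) (hi 0 _) (hi r 0)]

theorem generator_eq_of_tendstoUniformly {E : Type*} [MeasurableSpace E] {Λ : PathLaws E}
    {f l : E → ℝ} (h : TendstoUniformly (differenceQuotient Λ f) l (𝓝[>] (0 : ℝ≥0))) :
    generator Λ f = l :=
  funext fun x => (h.tendsto_at x).limUnder_eq

theorem mem_generatorDomain_of_tendstoUniformly {E : Type*} [MeasurableSpace E]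
    {C : Submodule ℝ (E → ℝ)} {Λ : PathLaws E} {f l : E → ℝ} (hf : f ∈ C) (hl : l ∈ C)
    (h : TendstoUniformly (differenceQuotient Λ f) l (𝓝[>] (0 : ℝ≥0))) :
    f ∈ generatorDomain C Λ := by
  have := generator_eq_of_tendstoUniformly h
  exact ⟨hf, by rwa [this], by rwa [this]⟩

namespace MarkovFamily

variable {E Ω : Type*} [MeasurableSpace E] [MeasurableSpace Ω] (𝒳 : MarkovFamily E Ω)

theorem laws_dirac (t : ℝ≥0) (x : E) :
    𝒳.laws t (Measure.dirac x) = (𝒳.P x).map (𝒳.path t) := by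
  rw [laws, Measure.dirac_bind 𝒳.measurable_P]

theorem semigroup_laws {f : E → ℝ} (hf : Measurable f) (t : ℝ≥0) (x : E) :
    semigroup 𝒳.laws t f x = ∫ ω, f (𝒳.X t ω) ∂(𝒳.P x) := by
  rw [semigroup, laws_dirac, integral_map (𝒳.measurable_path t).aemeasurable
    (f := fun γ => f (γ ⟨t, Set.mem_Iic.2 le_rfl⟩)) (hf.comp (measurable_pi_apply _)).aestronglyMeasurable]
  rfl

theorem integrable_comp_X {f : E → ℝ} (hf : Measurable f) {K : ℝ} (hK : ∀ x, |f x| ≤ K)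
    (t : ℝ≥0) (x : E) : Integrable (fun ω => f (𝒳.X t ω)) (𝒳.P x) := by
  have := 𝒳.isMarkovKernel
  exact Integrable.of_bound (hf.comp (𝒳.measurable_X t)).aestronglyMeasurable K
    (ae_of_all _ fun ω => hK _)

theorem abs_semigroup_le {f : E → ℝ} (hf : Measurable f) {K : ℝ} (hK : ∀ x, |f x| ≤ K)
    (t : ℝ≥0) (x : E) : |semigroup 𝒳.laws t f x| ≤ K := by
  have := 𝒳.isMarkovKernel
  rw [𝒳.semigroup_laws hf]
  simpa using norm_integral_le_of_norm_le_const (μ := 𝒳.P x) (f := fun ω => f (𝒳.X t ω))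
    (ae_of_all _ fun ω => hK (𝒳.X t ω))

/-- Chapman-Kolmogorov, obtained by integrating the conditional Markov property. -/
theorem map_X_add (s t : ℝ≥0) (x : E) :
    (𝒳.P x).map (𝒳.X (s + t)) = (𝒳.P.map (𝒳.X t) ∘ₖ 𝒳.P.map (𝒳.X s)) x := by
  have := 𝒳.isMarkovKernel
  ext A hA
  have hmA := 𝒳.measurable_X t hA
  have hP : Measurable fun y => 𝒳.P y (𝒳.X t ⁻¹' A) := 𝒳.P.measurable_coe hmA
  rw [Measure.map_apply (𝒳.measurable_X _) hA, Kernel.comp_apply' _ _ _ hA]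
  simp_rw [Kernel.map_apply' _ (𝒳.measurable_X t) _ hA]
  rw [Kernel.map_apply _ (𝒳.measurable_X s), lintegral_map hP (𝒳.measurable_X s)]
  have h1 := integral_congr_ae (𝒳.markov x s t A hA)
  rw [integral_condExp (𝒳.past_le s), integral_indicator (𝒳.measurable_X _ hA)] at h1
  simp only [setIntegral_const, smul_eq_mul, mul_one, Measure.real] at h1
  rw [integral_toReal (f := fun ω => 𝒳.P (𝒳.X s ω) (𝒳.X t ⁻¹' A)) (hP.comp (𝒳.measurable_X s)).aemeasurable
    (ae_of_all _ fun ω => measure_lt_top _ _)] at h1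
  refine (ENNReal.toReal_eq_toReal_iff' (measure_ne_top _ _) (ne_of_lt ?_)).1 h1
  calc _ ≤ ∫⁻ _, 1 ∂(𝒳.P x) := lintegral_mono fun ω => prob_le_one
    _ < ⊤ := by simp

variable {𝒳} {C : Submodule ℝ (E → ℝ)} (hC : IsSemigroupSpace C 𝒳.laws)

include hC

theorem semigroup_add {f : E → ℝ} (hf : f ∈ C) (s t : ℝ≥0) (x : E) :
    semigroup 𝒳.laws (s + t) f x = semigroup 𝒳.laws s (semigroup 𝒳.laws t f) x := by
  have := 𝒳.isMarkovKernel
  have hm := hC.measurable f hf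
  obtain ⟨K, hK⟩ := hC.bounded f hf
  rw [𝒳.semigroup_laws hm, 𝒳.semigroup_laws (hC.measurable _ (hC.invariant t f hf)),
    ← integral_map (𝒳.measurable_X _).aemeasurable hm.aestronglyMeasurable, 𝒳.map_X_add,
    Kernel.integral_comp]
  · simp_rw [Kernel.map_apply _ (𝒳.measurable_X _)]
    rw [integral_map (𝒳.measurable_X _).aemeasurable]
    · refine integral_congr_ae (ae_of_all _ fun ω => ?_)
      simp only
      rw [integral_map (𝒳.measurable_X _).aemeasurable hm.aestronglyMeasurable,
        𝒳.semigroup_laws hm]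
    · refine (Measurable.aestronglyMeasurable ?_)
      convert hC.measurable _ (hC.invariant t f hf) using 1
      funext y
      rw [integral_map (𝒳.measurable_X _).aemeasurable hm.aestronglyMeasurable,
        𝒳.semigroup_laws hm]
  · rw [← 𝒳.map_X_add]
    have : IsProbabilityMeasure ((𝒳.P x).map (𝒳.X (s + t))) :=
      Measure.isProbabilityMeasure_map (𝒳.measurable_X _).aemeasurable
    exact Integrable.of_bound hm.aestronglyMeasurable K (ae_of_all _ hK)

theorem semigroup_map_add {f g : E → ℝ} (hf : f ∈ C) (hg : g ∈ C) (t : ℝ≥0) :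
    semigroup 𝒳.laws t (f + g) = semigroup 𝒳.laws t f + semigroup 𝒳.laws t g := by
  obtain ⟨K, hK⟩ := hC.bounded f hf
  obtain ⟨K', hK'⟩ := hC.bounded g hg
  funext x
  rw [Pi.add_apply, 𝒳.semigroup_laws (hC.measurable _ hf), 𝒳.semigroup_laws (hC.measurable _ hg),
    𝒳.semigroup_laws (hC.measurable _ (C.add_mem hf hg))]
  exact integral_add (𝒳.integrable_comp_X (hC.measurable _ hf) hK t x)
    (𝒳.integrable_comp_X (hC.measurable _ hg) hK' t x)

theorem semigroup_map_smul {f : E → ℝ} (hf : f ∈ C) (a : ℝ) (t : ℝ≥0) :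
    semigroup 𝒳.laws t (a • f) = a • semigroup 𝒳.laws t f := by
  funext x
  rw [Pi.smul_apply, 𝒳.semigroup_laws (hC.measurable _ hf),
    𝒳.semigroup_laws (hC.measurable _ (C.smul_mem a hf))]
  exact integral_const_mul _ _

/-- The domain of the generator is dense. -/
theorem exists_mem_generatorDomain_near {f : E → ℝ} (hf : f ∈ C) {ε : ℝ} (hε : 0 < ε) :
    ∃ h ∈ generatorDomain C 𝒳.laws, ∀ x, |h x - f x| ≤ ε := by
  -- For the discrete topology every bounded function is bounded continuous, so `C` becomes a closed
  -- subspace of a Banach space.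
  let _ : TopologicalSpace E := ⊥
  have : DiscreteTopology E := ⟨rfl⟩
  let Y : Submodule ℝ (E →ᵇ ℝ) :=
    { carrier := {u | (u : E → ℝ) ∈ C}
      add_mem' := fun hu hv => C.add_mem hu hv
      zero_mem' := C.zero_mem
      smul_mem' := fun a _ hu => C.smul_mem a hu }
  have hYmem : ∀ u : Y, ((u : E →ᵇ ℝ) : E → ℝ) ∈ C := fun u => u.2
  have hYclosed : IsClosed (Y : Set (E →ᵇ ℝ)) := by
    refine isClosed_of_closure_subset fun u hu => ?_
    refine hC.uniformly_closed _ fun ε hε => ?_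
    obtain ⟨v, hv, huv⟩ := Metric.mem_closure_iff.1 hu ε hε
    refine ⟨v, hv, fun x => ?_⟩
    rw [← Real.dist_eq, dist_comm]
    exact (BoundedContinuousFunction.dist_coe_le_dist x).trans huv.le
  have : CompleteSpace Y := hYclosed.completeSpace_coe
  have hlift : ∀ g ∈ C, ∃ u : Y, ∀ x, (u : E →ᵇ ℝ) x = g x := fun g hg => by
    obtain ⟨K, hK⟩ := hC.bounded g hg
    exact ⟨⟨BoundedContinuousFunction.ofNormedAddCommGroupDiscrete g K hK, hg⟩, fun x => rfl⟩
  choose lift hliftx using hlift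
  let S : ℝ≥0 → Y →L[ℝ] Y := fun t =>
    LinearMap.mkContinuous
      { toFun := fun u : Y =>
          lift (semigroup 𝒳.laws t ((u : E →ᵇ ℝ) : E → ℝ)) (hC.invariant t _ (hYmem u))
        map_add' := fun u v => by
          ext x
          have := congrFun (semigroup_map_add hC (hYmem u) (hYmem v) t) x
          simpa [hliftx] using this
        map_smul' := fun a u => by
          ext x
          have := congrFun (semigroup_map_smul hC (hYmem u) a t) x
          simpa [hliftx, Pi.smul_def] using this } 1
      (fun u => by
        rw [one_mul]
        refine (BoundedContinuousFunction.norm_le (norm_nonneg (u : E →ᵇ ℝ))).2 fun x => ?_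
        change ‖(lift (semigroup 𝒳.laws t ((u : E →ᵇ ℝ) : E → ℝ)) _ : E →ᵇ ℝ) x‖ ≤ _
        rw [hliftx]
        exact 𝒳.abs_semigroup_le (hC.measurable _ u.2)
          (fun x => BoundedContinuousFunction.norm_coe_le_norm (u : E →ᵇ ℝ) x) t x)
  have hS : ∀ t u x, (S t u : E →ᵇ ℝ) x = semigroup 𝒳.laws t ((u : E →ᵇ ℝ) : E → ℝ) x :=
    fun t u x => hliftx _ _ x
  have hS' : ∀ t u, ((S t u : E →ᵇ ℝ) : E → ℝ) = semigroup 𝒳.laws t ((u : E →ᵇ ℝ) : E → ℝ) :=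
    fun t u => funext (hS t u)
  obtain ⟨z, w, hz, hw⟩ := exists_near_hasGenerator S
    (fun s t u => by
      ext x
      rw [hS, hS, hS', semigroup_add hC u.2])
    (fun t u => by
      change ‖(S t u : E →ᵇ ℝ)‖ ≤ ‖(u : E →ᵇ ℝ)‖
      refine (BoundedContinuousFunction.norm_le (norm_nonneg _)).2 fun x => ?_
      rw [hS]
      exact 𝒳.abs_semigroup_le (hC.measurable _ u.2)
        (fun x => BoundedContinuousFunction.norm_coe_le_norm (u : E →ᵇ ℝ) x) t x)
    (fun u => by
      rw [tendsto_subtype_rng, BoundedContinuousFunction.tendsto_iff_tendstoUniformly]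
      simp_rw [hS']
      exact hC.strongly_continuous _ u.2)
    (lift f hf) hε
  refine ⟨((z : E →ᵇ ℝ) : E → ℝ), mem_generatorDomain_of_tendstoUniformly z.2 w.2 ?_,
    fun x => ?_⟩
  · rw [tendsto_subtype_rng, BoundedContinuousFunction.tendsto_iff_tendstoUniformly] at hw
    convert hw using 2 with t
    funext x
    simp [differenceQuotient, hS, div_eq_inv_mul]
  · have := (BoundedContinuousFunction.norm_coe_le_norm ((z - lift f hf : Y) : E →ᵇ ℝ) x).trans
      hz.le
    simpa [hliftx] using this

end MarkovFamily

/-! ### Algebraic structure and closedness of the generator. -/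

namespace MarkovFamily

variable {E Ω : Type*} [MeasurableSpace E] [MeasurableSpace Ω] {𝒳 : MarkovFamily E Ω}
  {C : Submodule ℝ (E → ℝ)} (hC : IsSemigroupSpace C 𝒳.laws)

section Linear

include hC

theorem differenceQuotient_add {f g : E → ℝ} (hf : f ∈ C) (hg : g ∈ C) (t : ℝ≥0) :
    differenceQuotient 𝒳.laws (f + g) t
      = differenceQuotient 𝒳.laws f t + differenceQuotient 𝒳.laws g t := by
  funext x
  simp only [differenceQuotient, semigroup_map_add hC hf hg, Pi.add_apply]
  ring

theorem differenceQuotient_smul {f : E → ℝ} (hf : f ∈ C) (a : ℝ) (t : ℝ≥0) :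
    differenceQuotient 𝒳.laws (a • f) t = a • differenceQuotient 𝒳.laws f t := by
  funext x
  simp only [differenceQuotient, semigroup_map_smul hC hf, Pi.smul_apply, smul_eq_mul]
  ring

theorem differenceQuotient_sub {f g : E → ℝ} (hf : f ∈ C) (hg : g ∈ C) (t : ℝ≥0) :
    differenceQuotient 𝒳.laws (f - g) t
      = differenceQuotient 𝒳.laws f t - differenceQuotient 𝒳.laws g t := by
  have h : f - g = f + (-1 : ℝ) • g := by rw [neg_one_smul, sub_eq_add_neg]
  rw [h, differenceQuotient_add hC hf (C.smul_mem _ hg), differenceQuotient_smul hC hg,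
    neg_one_smul, sub_eq_add_neg]

theorem add_mem_generatorDomain {f g : E → ℝ} (hf : f ∈ generatorDomain C 𝒳.laws)
    (hg : g ∈ generatorDomain C 𝒳.laws) : f + g ∈ generatorDomain C 𝒳.laws := by
  refine mem_generatorDomain_of_tendstoUniformly (C.add_mem hf.1 hg.1)
    (C.add_mem hf.2.1 hg.2.1) ?_
  convert hf.2.2.add hg.2.2 using 1
  exact funext fun t => differenceQuotient_add hC hf.1 hg.1 t

theorem smul_mem_generatorDomain {f : E → ℝ} (hf : f ∈ generatorDomain C 𝒳.laws) (a : ℝ) :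
    a • f ∈ generatorDomain C 𝒳.laws := by
  refine mem_generatorDomain_of_tendstoUniformly (C.smul_mem a hf.1)
    (C.smul_mem a hf.2.1) ?_
  convert (uniformContinuous_const_smul a).comp_tendstoUniformly hf.2.2 using 1
  · exact funext fun t => differenceQuotient_smul hC hf.1 a t
  · rfl

theorem sub_mem_generatorDomain {f g : E → ℝ} (hf : f ∈ generatorDomain C 𝒳.laws)
    (hg : g ∈ generatorDomain C 𝒳.laws) : f - g ∈ generatorDomain C 𝒳.laws := by
  have h : f - g = f + (-1 : ℝ) • g := by rw [neg_one_smul, sub_eq_add_neg]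
  rw [h]
  exact add_mem_generatorDomain hC hf (smul_mem_generatorDomain hC hg _)

theorem eventually_abs_differenceQuotient_le {f : E → ℝ} (hf : f ∈ generatorDomain C 𝒳.laws) :
    ∃ K : ℝ, 0 ≤ K ∧ ∀ᶠ t in 𝓝[>] (0 : ℝ≥0), ∀ x, |differenceQuotient 𝒳.laws f t x| ≤ K := by
  obtain ⟨K, hK⟩ := hC.bounded _ hf.2.1
  refine ⟨|K| + 1, by positivity, (Metric.tendstoUniformly_iff.1 hf.2.2 1 one_pos).mono
    fun t ht x => ?_⟩
  have h1 := ht x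
  rw [Real.dist_eq] at h1
  have h2 := hK x
  have h3 := abs_sub_abs_le_abs_sub (differenceQuotient 𝒳.laws f t x) (generator 𝒳.laws f x)
  rw [abs_sub_comm] at h3
  linarith [le_abs_self K]

/-- The domain is dense in `C` and multiplication is continuous in the supremum norm on bounded
sets, so closure under products extends from the domain to `C`. -/
theorem mul_mem_of_generatorDomain
    (hmul : ∀ f ∈ generatorDomain C 𝒳.laws, ∀ g ∈ generatorDomain C 𝒳.laws,
      f * g ∈ generatorDomain C 𝒳.laws) {f g : E → ℝ} (hf : f ∈ C) (hg : g ∈ C) :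
    f * g ∈ C := by
  refine hC.uniformly_closed _ fun ε hε => ?_
  obtain ⟨K, hK⟩ := hC.bounded f hf
  obtain ⟨N, hN⟩ := hC.bounded g hg
  have hpos : 0 < |K| + |N| + 1 := by positivity
  obtain ⟨δ, hδ, hδ1, hδε⟩ : ∃ δ : ℝ, 0 < δ ∧ δ ≤ 1 ∧ δ * (|K| + |N| + 1) ≤ ε :=
    ⟨min 1 (ε / (|K| + |N| + 1)), by positivity, min_le_left _ _,
      (le_div_iff₀ hpos).1 (min_le_right _ _)⟩
  obtain ⟨f', hf', hff⟩ := exists_mem_generatorDomain_near hC hf hδ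
  obtain ⟨g', hg', hgg⟩ := exists_mem_generatorDomain_near hC hg hδ
  refine ⟨f' * g', (hmul f' hf' g' hg').1, fun x => ?_⟩
  have h1 : |g' x| ≤ |N| + 1 := by
    have := abs_sub_abs_le_abs_sub (g' x) (g x)
    linarith [hN x, hgg x, le_abs_self N]
  calc |(f' * g') x - (f * g) x| = |(f' x - f x) * g' x + f x * (g' x - g x)| := by
        congr 1; simp only [Pi.mul_apply]; ring
    _ ≤ |f' x - f x| * |g' x| + |f x| * |g' x - g x| := by
        rw [← abs_mul, ← abs_mul]; exact abs_add_le _ _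
    _ ≤ δ * (|N| + 1) + |K| * δ := by
        refine add_le_add (mul_le_mul (hff x) h1 (abs_nonneg _) hδ.le)
          (mul_le_mul ((hK x).trans (le_abs_self K)) (hgg x) (abs_nonneg _) (abs_nonneg _))
    _ = δ * (|K| + |N| + 1) := by ring
    _ ≤ ε := hδε

/-- Second order Taylor bound for the difference quotients. -/
theorem abs_differenceQuotient_le_of_taylor {f r d : E → ℝ} (hf : f ∈ C) (hff : f * f ∈ C)
    (hr : r ∈ C) {e : ℝ} (h : ∀ x y, |r y - r x - d x * (f y - f x)| ≤ e * (f y - f x) ^ 2)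
    (t : ℝ≥0) (x : E) :
    |differenceQuotient 𝒳.laws r t x| ≤ |d x| * |differenceQuotient 𝒳.laws f t x|
      + |e| * (|differenceQuotient 𝒳.laws (f * f) t x|
        + 2 * |f x| * |differenceQuotient 𝒳.laws f t x|) := by
  have := 𝒳.isMarkovKernel
  have hint : ∀ g ∈ C, Integrable (fun ω => g (𝒳.X t ω)) (𝒳.P x) := fun g hg => by
    obtain ⟨K, hK⟩ := hC.bounded g hg
    exact 𝒳.integrable_comp_X (hC.measurable g hg) hK t x
  have hS : ∀ g ∈ C, semigroup 𝒳.laws t g x = ∫ ω, g (𝒳.X t ω) ∂(𝒳.P x) := fun g hg =>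
    𝒳.semigroup_laws (hC.measurable g hg) t x
  have i1 := hint f hf
  have i2 := hint _ hff
  have i3 := hint r hr
  have key : ∀ a b c k : ℝ, ∫ ω, (a * r (𝒳.X t ω) + b * f (𝒳.X t ω) + c * (f * f) (𝒳.X t ω) + k)
      ∂(𝒳.P x) = a * semigroup 𝒳.laws t r x + b * semigroup 𝒳.laws t f x
        + c * semigroup 𝒳.laws t (f * f) x + k := by
    intro a b c k
    have j1 := i3.const_mul a
    have j2 := i1.const_mul b
    have j3 := i2.const_mul c
    have j4 : Integrable (fun ω => a * r (𝒳.X t ω) + b * f (𝒳.X t ω)) (𝒳.P x) := j1.add j2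
    have j5 : Integrable (fun ω => a * r (𝒳.X t ω) + b * f (𝒳.X t ω) + c * (f * f) (𝒳.X t ω))
      (𝒳.P x) := j4.add j3
    rw [integral_add j5 (integrable_const k), integral_add j4 j3, integral_add j1 j2,
      integral_const_mul, integral_const_mul,
      integral_const_mul, hS _ hr, hS _ hf, hS _ hff]
    simp
  -- The expectation of one side of the Taylor inequality at $y=X_t$, with the square expanded so
  -- that only the semigroup at `r`, `f` and `f * f` appears; `hlo` is the other side.
  have hup : 0 ≤ -1 * semigroup 𝒳.laws t r x + (d x - 2 * e * f x) * semigroup 𝒳.laws t f x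
      + e * semigroup 𝒳.laws t (f * f) x + (r x - d x * f x + e * f x ^ 2) := by
    rw [← key]
    refine integral_nonneg fun ω => ?_
    have := (abs_le.1 (h x (𝒳.X t ω))).2
    simp only [Pi.zero_apply, Pi.mul_apply]
    nlinarith [this]
  have hlo : 0 ≤ 1 * semigroup 𝒳.laws t r x + (-d x - 2 * e * f x) * semigroup 𝒳.laws t f x
      + e * semigroup 𝒳.laws t (f * f) x + (-r x + d x * f x + e * f x ^ 2) := by
    rw [← key]
    refine integral_nonneg fun ω => ?_
    have := (abs_le.1 (h x (𝒳.X t ω))).1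
    simp only [Pi.zero_apply, Pi.mul_apply]
    nlinarith [this]
  set R := semigroup 𝒳.laws t r x - r x with hR
  set D := semigroup 𝒳.laws t f x - f x with hD
  set Q := semigroup 𝒳.laws t (f * f) x - (f * f) x with hQ
  simp only [Pi.mul_apply] at hQ
  -- Here $Q-2f(x)D=\mathbb E_x(f(X_t)-f(x))^2$.
  have hmain : |R - d x * D| ≤ e * (Q - 2 * f x * D) := by
    rw [abs_le]
    constructor
    · rw [hR, hD, hQ]; nlinarith [hlo]
    · rw [hR, hD, hQ]; nlinarith [hup]
  have h2 : |R| ≤ |d x| * |D| + |e| * (|Q| + 2 * |f x| * |D|) := by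
    calc |R| = |d x * D + (R - d x * D)| := by congr 1; ring
      _ ≤ |d x * D| + |R - d x * D| := abs_add_le _ _
      _ ≤ |d x| * |D| + |e * (Q - 2 * f x * D)| := by
          rw [abs_mul]
          exact add_le_add le_rfl (hmain.trans (le_abs_self _))
      _ ≤ |d x| * |D| + |e| * (|Q| + 2 * |f x| * |D|) := by
          rw [abs_mul]
          gcongr
          refine (abs_sub _ _).trans_eq ?_
          rw [abs_mul, abs_mul, abs_two]
  have ht : |(t : ℝ)| = t := abs_of_nonneg t.coe_nonneg
  simp only [differenceQuotient, abs_div, ht, ← hR, ← hD, Pi.mul_apply, ← hQ]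
  calc |R| / t ≤ (|d x| * |D| + |e| * (|Q| + 2 * |f x| * |D|)) / t := by gcongr
    _ = _ := by ring

/-- The generator is closed. -/
theorem mem_generatorDomain_of_seq {s : E → ℝ} (hs : s ∈ C) {S : ℕ → E → ℝ}
    (hS : ∀ n, S n ∈ generatorDomain C 𝒳.laws)
    (h : ∀ ε > 0, ∀ᶠ n in atTop, ∀ᶠ t in 𝓝[>] (0 : ℝ≥0),
      ∀ x, |differenceQuotient 𝒳.laws (s - S n) t x| ≤ ε) :
    s ∈ generatorDomain C 𝒳.laws := by
  have hA : ∀ n t x, differenceQuotient 𝒳.laws (s - S n) t x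
      = differenceQuotient 𝒳.laws s t x - differenceQuotient 𝒳.laws (S n) t x := fun n t x =>
    congrFun (differenceQuotient_sub hC hs (hS n).1 t) x
  simp_rw [hA] at h
  have hL : ∀ n x, Tendsto (fun t => differenceQuotient 𝒳.laws (S n) t x) (𝓝[>] (0 : ℝ≥0))
      (𝓝 (generator 𝒳.laws (S n) x)) := fun n x => (hS n).2.2.tendsto_at x
  -- For large `n` and `m` both quotients are close to that of `s`; letting $t\downarrow0$ shows
  -- that the functions $LS_n$ are uniformly Cauchy.
  have hclose : ∀ ε > 0, ∃ N, ∀ n ≥ N, ∀ m ≥ N, ∀ x,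
      |generator 𝒳.laws (S n) x - generator 𝒳.laws (S m) x| ≤ ε := by
    intro ε hε
    obtain ⟨N, hN⟩ := eventually_atTop.1 (h (ε / 2) (half_pos hε))
    refine ⟨N, fun n hn m hm x => ?_⟩
    refine le_of_tendsto ((hL n x).sub (hL m x)).abs ?_
    filter_upwards [hN n hn, hN m hm] with t h1 h2
    have h3 := abs_le.1 (h1 x)
    have h4 := abs_le.1 (h2 x)
    rw [abs_le]
    constructor <;> linarith
  have hlim : ∀ x, ∃ l, Tendsto (fun n => generator 𝒳.laws (S n) x) atTop (𝓝 l) := by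
    intro x
    refine cauchySeq_tendsto_of_complete (Metric.cauchySeq_iff'.2 fun ε hε => ?_)
    obtain ⟨N, hN⟩ := hclose (ε / 2) (half_pos hε)
    exact ⟨N, fun n hn => by
      rw [Real.dist_eq]; exact (hN n hn N le_rfl x).trans_lt (half_lt_self hε)⟩
  choose l hl using hlim
  have hunif : ∀ ε > 0, ∃ N, ∀ n ≥ N, ∀ x, |generator 𝒳.laws (S n) x - l x| ≤ ε := by
    intro ε hε
    obtain ⟨N, hN⟩ := hclose ε hε
    exact ⟨N, fun n hn x => le_of_tendsto (tendsto_const_nhds.sub (hl x)).abs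
      (eventually_atTop.2 ⟨N, fun m hm => hN n hn m hm x⟩)⟩
  refine mem_generatorDomain_of_tendstoUniformly (l := l) hs
    (hC.uniformly_closed l fun ε hε => ?_) (Metric.tendstoUniformly_iff.2 fun ε hε => ?_)
  · obtain ⟨N, hN⟩ := hunif ε hε
    exact ⟨_, (hS N).2.1, hN N le_rfl⟩
  · have h4 : 0 < ε / 4 := by positivity
    obtain ⟨N, hN⟩ := hunif (ε / 4) h4
    obtain ⟨N', hN'⟩ := eventually_atTop.1 (h (ε / 4) h4)
    filter_upwards [hN' (max N N') (le_max_right _ _),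
      Metric.tendstoUniformly_iff.1 (hS (max N N')).2.2 (ε / 4) h4] with t h1 h2 x
    have h5 := abs_le.1 (hN (max N N') (le_max_left _ _) x)
    have h6 := abs_le.1 (h1 x)
    have h7 := abs_lt.1 (Real.dist_eq _ _ ▸ h2 x)
    rw [Real.dist_eq, abs_lt]
    constructor <;> linarith [h5.1, h5.2, h6.1, h6.2, h7.1, h7.2]

end Linear

end MarkovFamily

/-! ### Taylor estimates for the geometric series. -/

/-- The remainders satisfy $R_{k+1}=aR_k+(k+2)b^{k+1}(a-b)^2$, and the constant propagates because
$(k+2)^2+(k+2)\le(k+3)^2$. -/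
theorem abs_pow_sub_pow_sub_le {M a b : ℝ} (ha : |a| ≤ M) (hb : |b| ≤ M) (k : ℕ) :
    |a ^ (k + 2) - b ^ (k + 2) - (k + 2) * b ^ (k + 1) * (a - b)|
      ≤ (k + 2) ^ 2 * M ^ k * (a - b) ^ 2 := by
  have hM : 0 ≤ M := (abs_nonneg a).trans ha
  have hd : 0 ≤ (a - b) ^ 2 := sq_nonneg _
  induction k with
  | zero =>
    have e : a ^ (0 + 2) - b ^ (0 + 2) - ((0 : ℕ) + 2) * b ^ (0 + 1) * (a - b) = (a - b) ^ 2 := by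
      push_cast; ring
    rw [e, abs_of_nonneg hd]
    push_cast
    linarith
  | succ k ih =>
    have e : a ^ (k + 1 + 2) - b ^ (k + 1 + 2) - ((k + 1 : ℕ) + 2) * b ^ (k + 1 + 1) * (a - b)
        = a * (a ^ (k + 2) - b ^ (k + 2) - (k + 2) * b ^ (k + 1) * (a - b))
          + (k + 2) * b ^ (k + 1) * (a - b) ^ 2 := by
      push_cast; ring
    have hk : (0 : ℝ) ≤ k + 2 := by positivity
    rw [e]
    refine (abs_add_le _ _).trans ?_
    rw [abs_mul, abs_mul, abs_mul, abs_pow, abs_of_nonneg hd, abs_of_nonneg hk]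
    have h1 : |b| ^ (k + 1) ≤ M ^ (k + 1) := pow_le_pow_left₀ (abs_nonneg _) hb _
    calc _ ≤ M * ((k + 2) ^ 2 * M ^ k * (a - b) ^ 2) + (k + 2) * M ^ (k + 1) * (a - b) ^ 2 := by
          gcongr
      _ = ((k + 2) ^ 2 + (k + 2)) * (M ^ (k + 1) * (a - b) ^ 2) := by ring
      _ ≤ ((k + 1 : ℕ) + 2) ^ 2 * (M ^ (k + 1) * (a - b) ^ 2) := by
          gcongr
          push_cast
          nlinarith
      _ = _ := by ring

/-- Second order Taylor bounds for the tails of the geometric series. -/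
theorem geometric_tail_taylor {M a b : ℝ} (hM1 : M < 1) (ha0 : 0 ≤ a) (ha : a ≤ M) (hb0 : 0 ≤ b)
    (hb : b ≤ M) (k : ℕ) :
    |a ^ (k + 2) * (1 - a)⁻¹ - b ^ (k + 2) * (1 - b)⁻¹
        - ((k + 2) * b ^ (k + 1) * (1 - b)⁻¹ + b ^ (k + 2) * ((1 - b)⁻¹) ^ 2) * (a - b)|
      ≤ (3 * (k + 2) ^ 2 * M ^ k * ((1 - M)⁻¹) ^ 3) * (a - b) ^ 2 ∧
    |(k + 2) * b ^ (k + 1) * (1 - b)⁻¹ + b ^ (k + 2) * ((1 - b)⁻¹) ^ 2|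
      ≤ 3 * (k + 2) ^ 2 * M ^ k * ((1 - M)⁻¹) ^ 3 ∧
    |b ^ (k + 2) * (1 - b)⁻¹| ≤ 3 * (k + 2) ^ 2 * M ^ k * ((1 - M)⁻¹) ^ 3 := by
  have hM0 : 0 ≤ M := ha0.trans ha
  have hM : 0 < 1 - M := sub_pos.2 hM1
  have ha1 : 0 < 1 - a := by linarith
  have hb1 : 0 < 1 - b := by linarith
  have hp : 1 ≤ (1 - M)⁻¹ := (one_le_inv₀ hM).2 (by linarith)
  have hpa : (1 - a)⁻¹ ≤ (1 - M)⁻¹ := inv_anti₀ hM (by linarith)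
  have hpb : (1 - b)⁻¹ ≤ (1 - M)⁻¹ := inv_anti₀ hM (by linarith)
  have hqa : 0 < (1 - a)⁻¹ := inv_pos.2 ha1
  have hqb : 0 < (1 - b)⁻¹ := inv_pos.2 hb1
  have hid : (1 - a)⁻¹ = (1 - b)⁻¹ + (a - b) * ((1 - a)⁻¹ * (1 - b)⁻¹) := by
    field_simp
    ring
  set A := (1 - a)⁻¹
  set B := (1 - b)⁻¹
  set κ := (1 - M)⁻¹
  have hκ0 : 0 ≤ κ := zero_le_one.trans hp
  have hd : 0 ≤ (a - b) ^ 2 := sq_nonneg _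
  have hk : (2 : ℝ) ≤ k + 2 := by linarith [Nat.cast_nonneg (α := ℝ) k]
  have hk2 : (k + 2 : ℝ) ≤ (k + 2) ^ 2 := by nlinarith
  have hk1 : (1 : ℝ) ≤ (k + 2) ^ 2 := by nlinarith
  have hκ1 : κ ≤ κ ^ 3 := le_self_pow₀ hp (by norm_num)
  have hκ2 : κ ^ 2 ≤ κ ^ 3 := pow_le_pow_right₀ hp (by norm_num)
  have hb' : b ^ (k + 1) ≤ M ^ k :=
    (pow_le_pow_left₀ hb0 hb _).trans (pow_le_pow_of_le_one hM0 hM1.le (Nat.le_succ k))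
  have hb'' : b ^ (k + 2) ≤ M ^ k :=
    (pow_le_pow_left₀ hb0 hb _).trans (pow_le_pow_of_le_one hM0 hM1.le (by omega))
  have hMk : 0 ≤ M ^ k := pow_nonneg hM0 k
  have hX : 0 ≤ (k + 2) ^ 2 * M ^ k * κ ^ 3 := by positivity
  have hB2 : B ^ 2 ≤ κ ^ 3 := (pow_le_pow_left₀ hqb.le hpb 2).trans hκ2
  have t1 : (k + 2) * b ^ (k + 1) * B ≤ (k + 2) ^ 2 * M ^ k * κ ^ 3 := by
    gcongr
    exact hpb.trans hκ1
  have t2 : b ^ (k + 2) * B ^ 2 ≤ (k + 2) ^ 2 * M ^ k * κ ^ 3 := by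
    calc b ^ (k + 2) * B ^ 2 ≤ M ^ k * κ ^ 3 := by gcongr
      _ ≤ (k + 2) ^ 2 * (M ^ k * κ ^ 3) := le_mul_of_one_le_left (by positivity) hk1
      _ = _ := by ring
  -- One constant serves all three bounds. Its factor 3 comes from the first, where the remainder
  -- splits into the power remainder times `A` and two terms from expanding `A` around `B` by `hid`.
  refine ⟨?_, ?_, ?_⟩
  · have e : a ^ (k + 2) * A - b ^ (k + 2) * B
          - ((k + 2) * b ^ (k + 1) * B + b ^ (k + 2) * B ^ 2) * (a - b)
        = (a ^ (k + 2) - b ^ (k + 2) - (k + 2) * b ^ (k + 1) * (a - b)) * A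
          + ((k + 2) * b ^ (k + 1) * B * A + b ^ (k + 2) * (A * B ^ 2)) * (a - b) ^ 2 := by
      linear_combination (b ^ (k + 2) + (k + 2) * b ^ (k + 1) * (a - b)
        + b ^ (k + 2) * (a - b) * B) * hid
    rw [e]
    refine (abs_add_le _ _).trans ?_
    have s1 := abs_pow_sub_pow_sub_le (M := M) (a := a) (b := b)
      (by rwa [abs_of_nonneg ha0]) (by rwa [abs_of_nonneg hb0]) k
    rw [abs_mul _ A, abs_of_pos hqa]
    have s2 : 0 ≤ (k + 2) * b ^ (k + 1) * B * A + b ^ (k + 2) * (A * B ^ 2) := by positivity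
    rw [abs_of_nonneg (mul_nonneg s2 hd)]
    have s3 : |a ^ (k + 2) - b ^ (k + 2) - (k + 2) * b ^ (k + 1) * (a - b)| * A
        ≤ (k + 2) ^ 2 * M ^ k * κ ^ 3 * (a - b) ^ 2 := by
      calc _ ≤ (k + 2) ^ 2 * M ^ k * (a - b) ^ 2 * κ ^ 3 := by
            gcongr
            exact hpa.trans hκ1
        _ = _ := by ring
    have s4 : (k + 2) * b ^ (k + 1) * B * A ≤ (k + 2) ^ 2 * M ^ k * κ ^ 3 := by
      calc (k + 2) * b ^ (k + 1) * B * A ≤ (k + 2) ^ 2 * M ^ k * κ * κ := by gcongr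
        _ = (k + 2) ^ 2 * M ^ k * κ ^ 2 := by ring
        _ ≤ _ := by gcongr
    have s5 : b ^ (k + 2) * (A * B ^ 2) ≤ (k + 2) ^ 2 * M ^ k * κ ^ 3 := by
      calc b ^ (k + 2) * (A * B ^ 2) ≤ M ^ k * (κ * κ ^ 2) := by gcongr
        _ ≤ (k + 2) ^ 2 * (M ^ k * (κ * κ ^ 2)) := le_mul_of_one_le_left (by positivity) hk1
        _ = _ := by ring
    nlinarith [mul_le_mul_of_nonneg_right (add_le_add s4 s5) hd]
  · rw [abs_of_nonneg (by positivity)]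
    linarith
  · rw [abs_of_nonneg (by positivity)]
    calc b ^ (k + 2) * B ≤ M ^ k * κ ^ 3 := by
          gcongr
          exact hpb.trans hκ1
      _ ≤ (k + 2) ^ 2 * (M ^ k * κ ^ 3) := le_mul_of_one_le_left (by positivity) hk1
      _ ≤ _ := by linarith

theorem tendsto_geometric_tail_bound {M : ℝ} (hM0 : 0 < M) (hM1 : M < 1) (a : ℝ) :
    Tendsto (fun k : ℕ => 3 * ((k : ℝ) + 2) ^ 2 * M ^ k * a) atTop (𝓝 0) := by
  have h := (tendsto_pow_const_mul_const_pow_of_abs_lt_one 2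
    (by rwa [abs_of_pos hM0] : |M| < 1)).comp (tendsto_add_atTop_nat 2)
  -- The factor $M^{-2}$ undoes the index shift by two in the power of `M`.
  have h2 := h.const_mul (3 * a * (M ^ 2)⁻¹)
  rw [mul_zero] at h2
  refine h2.congr fun k => ?_
  simp only [Function.comp_apply]
  push_cast
  rw [pow_add]
  field_simp

/-! ### Units and inverses in the generator domain. -/

namespace MarkovFamily

variable {E Ω : Type*} [MeasurableSpace E] [MeasurableSpace Ω] {𝒳 : MarkovFamily E Ω}
  {C : Submodule ℝ (E → ℝ)} (hC : IsSemigroupSpace C 𝒳.laws)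

section Inverse

variable (hmul : ∀ f ∈ generatorDomain C 𝒳.laws, ∀ g ∈ generatorDomain C 𝒳.laws,
  f * g ∈ generatorDomain C 𝒳.laws)

include hC hmul

/-- Constants are not assumed to lie in `C`. The functions $1-(1-g/c')^n$ are polynomials in $g$
without constant term, hence in the domain, and tend uniformly to 1 because $0\le1-g/c'\le1-c/c'<1$.
Conservativity makes the difference quotients of 1 vanish. -/
theorem one_mem_generatorDomain {g : E → ℝ} (hg : g ∈ generatorDomain C 𝒳.laws) {c c' : ℝ}
    (hc : 0 < c) (hcc : c < c') (hgc : ∀ x, c ≤ g x ∧ g x ≤ c') :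
    (1 : E → ℝ) ∈ generatorDomain C 𝒳.laws := by
  have hc' : 0 < c' := hc.trans hcc
  have hpow : ∀ n : ℕ, (fun x => 1 - (1 - g x / c') ^ n) ∈ generatorDomain C 𝒳.laws := by
    intro n
    have hg' := smul_mem_generatorDomain hC hg c'⁻¹
    induction n with
    | zero =>
      convert smul_mem_generatorDomain hC hg 0 using 1
      funext x
      simp
    | succ n ih =>
      convert sub_mem_generatorDomain hC (add_mem_generatorDomain hC ih hg')
        (hmul _ ih _ hg') using 1
      funext x
      simp only [Pi.sub_apply, Pi.add_apply, Pi.mul_apply, Pi.smul_apply, smul_eq_mul]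
      ring
  have hM0 : 0 < 1 - c / c' := sub_pos.2 ((div_lt_one hc').2 hcc)
  have hM1 : 1 - c / c' < 1 := sub_lt_self _ (by positivity)
  have hone : (1 : E → ℝ) ∈ C := by
    refine hC.uniformly_closed _ fun ε hε => ?_
    obtain ⟨n, hn⟩ := exists_pow_lt_of_lt_one hε hM1
    refine ⟨_, (hpow n).1, fun x => ?_⟩
    have h0 : 0 ≤ 1 - g x / c' := sub_nonneg.2 ((div_le_one hc').2 (hgc x).2)
    have h1 : 1 - g x / c' ≤ 1 - c / c' := by gcongr; exact (hgc x).1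
    rw [Pi.one_apply, sub_sub_cancel_left, abs_neg, abs_of_nonneg (pow_nonneg h0 n)]
    exact (pow_le_pow_left₀ h0 h1 n).trans hn.le
  refine mem_generatorDomain_of_tendstoUniformly (l := 0) hone C.zero_mem ?_
  have hdq : differenceQuotient 𝒳.laws (1 : E → ℝ) = fun _ => 0 := by
    have := 𝒳.isMarkovKernel
    funext t x
    rw [differenceQuotient, 𝒳.semigroup_laws (hC.measurable _ hone)]
    simp
  rw [hdq]
  exact Metric.tendstoUniformly_iff.2 fun ε hε => Eventually.of_forall fun t x => by simpa using hε

/-- With $f=1-g/c'\in[0,M]$ and $M<1$, $c'/g$ is the sum of the geometric series in $f$. The tails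
$f^{k+2}/(1-f)$ are small uniformly, and by the Taylor bound so are their difference quotients,
whence closedness of the generator applies. -/
theorem inv_mem_generatorDomain {g : E → ℝ} (hg : g ∈ generatorDomain C 𝒳.laws) {c c' : ℝ}
    (hc : 0 < c) (hcc : c < c') (hgc : ∀ x, c ≤ g x ∧ g x ≤ c') :
    (fun x => (g x)⁻¹) ∈ generatorDomain C 𝒳.laws := by
  have hc' : 0 < c' := hc.trans hcc
  have hone := one_mem_generatorDomain hC hmul hg hc hcc hgc
  set M := 1 - c / c' with hM
  have hM0 : 0 < M := sub_pos.2 ((div_lt_one hc').2 hcc)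
  have hM1 : M < 1 := sub_lt_self _ (by positivity)
  let f : E → ℝ := 1 - c'⁻¹ • g
  have hf : f ∈ generatorDomain C 𝒳.laws :=
    sub_mem_generatorDomain hC hone (smul_mem_generatorDomain hC hg _)
  have hfx : ∀ x, f x = 1 - g x / c' := fun x => by
    simp only [f, Pi.sub_apply, Pi.one_apply, Pi.smul_apply, smul_eq_mul]; ring
  have hf0 : ∀ x, 0 ≤ f x := fun x => by
    rw [hfx]; exact sub_nonneg.2 ((div_le_one hc').2 (hgc x).2)
  have hfM : ∀ x, f x ≤ M := fun x => by
    rw [hfx, hM]; gcongr; exact (hgc x).1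
  have hf1 : ∀ x, f x ≠ 1 := fun x => ((hfM x).trans_lt hM1).ne
  have hpow : ∀ n : ℕ, f ^ n ∈ generatorDomain C 𝒳.laws := by
    intro n
    induction n with
    | zero => rwa [pow_zero]
    | succ n ih => rw [pow_succ]; exact hmul _ ih _ hf
  have hsum : ∀ n : ℕ, ∑ i ∈ Finset.range (n + 1), f ^ i ∈ generatorDomain C 𝒳.laws := by
    intro n
    induction n with
    | zero => simpa using hone
    | succ n ih => rw [Finset.sum_range_succ]; exact add_mem_generatorDomain hC ih (hpow _)
  let s : E → ℝ := fun x => (1 - f x)⁻¹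
  let r : ℕ → E → ℝ := fun k x => f x ^ (k + 2) * (1 - f x)⁻¹
  have hsr : ∀ k, s - ∑ i ∈ Finset.range (k + 1 + 1), f ^ i = r k := fun k => by
    funext x
    have h1 : 1 - f x ≠ 0 := sub_ne_zero.2 (hf1 x).symm
    have h2 : f x - 1 ≠ 0 := sub_ne_zero.2 (hf1 x)
    simp only [s, r, Pi.sub_apply, Finset.sum_apply, Pi.pow_apply, geom_sum_eq (hf1 x)]
    field_simp
    ring
  have htend := tendsto_geometric_tail_bound hM0 hM1 (((1 - M)⁻¹) ^ 3)
  have hs : s ∈ C := by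
    refine hC.uniformly_closed _ fun ε hε => ?_
    obtain ⟨k, hk⟩ := (htend.eventually (gt_mem_nhds hε)).exists
    refine ⟨_, (hsum (k + 1)).1, fun x => ?_⟩
    rw [abs_sub_comm, ← Pi.sub_apply, hsr]
    exact (geometric_tail_taylor hM1 (hf0 x) (hfM x) (hf0 x) (hfM x) k).2.2.trans hk.le
  have hsdom : s ∈ generatorDomain C 𝒳.laws := by
    refine mem_generatorDomain_of_seq hC hs (fun k => hsum (k + 1)) fun ε hε => ?_
    -- These bounds depend on `f` alone, not on `k`, so the factor tending to 0 in `k` wins.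
    obtain ⟨K, hK0, hK⟩ := eventually_abs_differenceQuotient_le hC hf
    obtain ⟨K', hK0', hK'⟩ := eventually_abs_differenceQuotient_le hC (hmul _ hf _ hf)
    have h1 := htend.mul_const (K + (K' + 2 * 1 * K))
    rw [zero_mul] at h1
    filter_upwards [h1.eventually (gt_mem_nhds hε)] with k hk
    filter_upwards [hK, hK'] with t ht ht' x
    have hr : r k ∈ C := by rw [← hsr]; exact C.sub_mem hs (hsum (k + 1)).1
    rw [hsr]
    refine (abs_differenceQuotient_le_of_taylor hC hf.1 (hmul _ hf _ hf).1 hr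
      (fun x y => (geometric_tail_taylor hM1 (hf0 y) (hfM y) (hf0 x) (hfM x) k).1) t x).trans
        (le_trans ?_ hk.le)
    have hpos : 0 ≤ 3 * ((k : ℝ) + 2) ^ 2 * M ^ k * ((1 - M)⁻¹) ^ 3 := by
      have : 0 < 1 - M := sub_pos.2 hM1
      positivity
    have hd := (geometric_tail_taylor hM1 (hf0 x) (hfM x) (hf0 x) (hfM x) k).2.1
    have hfx1 : |f x| ≤ 1 := by
      rw [abs_of_nonneg (hf0 x)]; exact (hfM x).trans hM1.le
    rw [abs_of_nonneg hpos]
    set e := 3 * ((k : ℝ) + 2) ^ 2 * M ^ k * ((1 - M)⁻¹) ^ 3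
    refine le_trans (add_le_add (mul_le_mul hd (ht x) (abs_nonneg _) hpos)
      (mul_le_mul_of_nonneg_left (add_le_add (ht' x) (mul_le_mul (b := 2 * 1) (by linarith) (ht x)
        (abs_nonneg _) (by norm_num))) hpos)) (mul_add e K _).ge
  convert smul_mem_generatorDomain hC hsdom c'⁻¹ using 1
  funext x
  have hgx : g x ≠ 0 := (hc.trans_le (hgc x).1).ne'
  simp only [s, hfx, Pi.smul_apply, smul_eq_mul, sub_sub_cancel]
  field_simp

end Inverse

end MarkovFamily

/-! ### The Feynman-Kac factor for small times. -/

namespace MarkovFamily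

variable {E Ω : Type*} [MeasurableSpace E] [MeasurableSpace Ω] (𝒳 : MarkovFamily E Ω)

/-- `∫_0^t H(X_s) ds`. -/
def additiveFunctional (H : E → ℝ) (t : ℝ≥0) (ω : Ω) : ℝ :=
  ∫ s in (0 : ℝ)..t, H (𝒳.X s.toNNReal ω)

theorem additiveFunctional_eq_clip (H : E → ℝ) (t : ℝ≥0) (ω : Ω) :
    𝒳.additiveFunctional H t ω = ∫ s in (0 : ℝ)..t, H (𝒳.path t ω (clip t s)) :=
  intervalIntegral.integral_congr fun s hs => by
    rw [Set.uIcc_of_le t.coe_nonneg] at hs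
    simp only [𝒳.path_clip hs.2]

theorem measurable_additiveFunctional {H : E → ℝ} (hH : Measurable H) (t : ℝ≥0) :
    Measurable (𝒳.additiveFunctional H t) := by
  have h : 𝒳.additiveFunctional H t
      = fun ω => ∫ s in Set.Ioc (0 : ℝ) t, H (𝒳.path t ω (clip t s)) := funext fun ω => by
    rw [𝒳.additiveFunctional_eq_clip, intervalIntegral.integral_of_le t.coe_nonneg]
  rw [h]
  exact (StronglyMeasurable.integral_prod_left'
    (hH.comp (𝒳.measurable_path_clip t)).stronglyMeasurable).measurable

theorem abs_additiveFunctional_le {H : E → ℝ} {K : ℝ} (hK : ∀ x, |H x| ≤ K) (t : ℝ≥0) (ω : Ω) :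
    |𝒳.additiveFunctional H t ω| ≤ K * t := by
  have := intervalIntegral.norm_integral_le_of_norm_le_const (a := 0) (b := t) (C := K)
    (f := fun s : ℝ => H (𝒳.X s.toNNReal ω)) (fun s _ => hK _)
  simpa [additiveFunctional] using this

theorem integral_additiveFunctional_sub {H : E → ℝ} (hH : Measurable H) {K : ℝ}
    (hK : ∀ x, |H x| ≤ K) (t : ℝ≥0) (x : E) :
    ∫ ω, (𝒳.additiveFunctional H t ω - t * H x) ∂(𝒳.P x)
      = ∫ s in (0 : ℝ)..t, (semigroup 𝒳.laws s.toNNReal H x - H x) := by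
  have := 𝒳.isMarkovKernel
  have hm := hH.comp (𝒳.measurable_path_clip t)
  have h1 : ∀ ω, 𝒳.additiveFunctional H t ω - t * H x
      = ∫ s in (0 : ℝ)..t, (H (𝒳.path t ω (clip t s)) - H x) := by
    intro ω
    rw [intervalIntegral.integral_sub, 𝒳.additiveFunctional_eq_clip,
      intervalIntegral.integral_const]
    · simp
    · rw [intervalIntegrable_iff]
      have : IsFiniteMeasure (volume.restrict (Set.uIoc (0 : ℝ) t)) := by
        rw [Set.uIoc_of_le t.coe_nonneg]; infer_instance
      exact Integrable.of_bound (hm.comp measurable_prodMk_right).aestronglyMeasurable K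
        (ae_of_all _ fun s => hK _)
    · exact intervalIntegrable_const
  simp_rw [h1]
  rw [← intervalIntegral_integral_swap]
  · refine intervalIntegral.integral_congr fun s hs => ?_
    rw [Set.uIcc_of_le t.coe_nonneg] at hs
    simp only [𝒳.path_clip hs.2]
    rw [integral_sub (𝒳.integrable_comp_X hH hK _ x) (integrable_const _), 𝒳.semigroup_laws hH]
    simp
  · rw [Set.uIoc_of_le t.coe_nonneg]
    refine Integrable.of_bound (C := K + K) (hm.sub measurable_const).aestronglyMeasurable
      (ae_of_all _ fun p => ?_)
    exact (norm_sub_le _ _).trans (add_le_add (hK _) (hK _))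

variable {𝒳} {C : Submodule ℝ (E → ℝ)} (hC : IsSemigroupSpace C 𝒳.laws)

include hC

/-- Strong continuity holds on a whole interval to the right of 0, which gives uniformity over all
$0<s\le t$, as needed under a time integral. -/
theorem eventually_abs_semigroup_sub_le {f : E → ℝ} (hf : f ∈ C) {ε : ℝ} (hε : 0 < ε) :
    ∀ᶠ t in 𝓝[>] (0 : ℝ≥0), ∀ s, 0 < s → s ≤ t → ∀ x, |semigroup 𝒳.laws s f x - f x| ≤ ε := by
  have h := Metric.tendstoUniformly_iff.1 (hC.strongly_continuous f hf) ε hε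
  obtain ⟨δ, hδ, hsub⟩ := mem_nhdsGT_iff_exists_Ioo_subset.1 h
  filter_upwards [Ioo_mem_nhdsGT (show (0 : ℝ≥0) < δ from hδ)] with t ht s hs0 hst x
  have := hsub ⟨hs0, hst.trans_lt ht.2⟩ x
  rw [Real.dist_eq, abs_sub_comm] at this
  exact this.le

theorem eventually_abs_integral_additiveFunctional_sub_le {H : E → ℝ} (hH : H ∈ C) {ε : ℝ}
    (hε : 0 < ε) : ∀ᶠ t in 𝓝[>] (0 : ℝ≥0), ∀ x,
      |∫ ω, (𝒳.additiveFunctional H t ω - t * H x) ∂(𝒳.P x)| ≤ ε * t := by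
  obtain ⟨K, hK⟩ := hC.bounded H hH
  filter_upwards [eventually_abs_semigroup_sub_le hC hH hε] with t ht x
  rw [𝒳.integral_additiveFunctional_sub (hC.measurable H hH) hK]
  have := intervalIntegral.norm_integral_le_of_norm_le_const (a := 0) (b := t) (C := ε)
    (f := fun s : ℝ => semigroup 𝒳.laws s.toNNReal H x - H x) (fun s hs => by
      rw [Set.uIoc_of_le t.coe_nonneg] at hs
      exact ht _ (Real.toNNReal_pos.2 hs.1) (Real.toNNReal_le_iff_le_coe.2 hs.2) x)
  simpa using this

/-- With $\eta=\varepsilon/2$, $|a|\le\eta+\eta^{-1}a^2$ reduces the first moment to $\mathbb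
E_x(u(X_t)-u(x))^2$, which strong continuity at $u$ and $u^2$ controls. No path continuity is
needed. -/
theorem eventually_integral_abs_sub_le {u : E → ℝ} (hu : u ∈ C) (huu : u * u ∈ C) {ε : ℝ}
    (hε : 0 < ε) :
    ∀ᶠ t in 𝓝[>] (0 : ℝ≥0), ∀ x, ∫ ω, |u (𝒳.X t ω) - u x| ∂(𝒳.P x) ≤ ε := by
  have := 𝒳.isMarkovKernel
  obtain ⟨K, hK⟩ := hC.bounded u hu
  obtain ⟨K', hK'⟩ := hC.bounded _ huu
  have hη : 0 < ε / 2 := half_pos hε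
  have hden : 0 < 1 + 2 * |K| := by positivity
  have hδ : 0 < (ε / 2) ^ 2 / (1 + 2 * |K|) := by positivity
  filter_upwards [eventually_abs_semigroup_sub_le hC hu hδ,
    eventually_abs_semigroup_sub_le hC huu hδ, eventually_mem_nhdsWithin] with t h1 h2 ht x
  replace h1 := h1 t ht le_rfl x
  replace h2 := h2 t ht le_rfl x
  have hm := hC.measurable u hu
  have i1 := 𝒳.integrable_comp_X hm hK t x
  have i2 := 𝒳.integrable_comp_X (hC.measurable _ huu) hK' t x
  have j1 := i2.const_mul ((ε / 2)⁻¹)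
  have j2 := i1.const_mul ((ε / 2)⁻¹ * (-2 * u x))
  have j3 : Integrable (fun ω => (ε / 2)⁻¹ * (u * u) (𝒳.X t ω)
    + (ε / 2)⁻¹ * (-2 * u x) * u (𝒳.X t ω)) (𝒳.P x) := j1.add j2
  calc ∫ ω, |u (𝒳.X t ω) - u x| ∂(𝒳.P x)
      ≤ ∫ ω, ((ε / 2)⁻¹ * (u * u) (𝒳.X t ω) + (ε / 2)⁻¹ * (-2 * u x) * u (𝒳.X t ω)
          + (ε / 2 + (ε / 2)⁻¹ * u x ^ 2)) ∂(𝒳.P x) := by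
        refine integral_mono (i1.sub (integrable_const _)).abs
          (j3.add (integrable_const _)) fun ω => ?_
        simp only [Pi.mul_apply]
        have h3 : |u (𝒳.X t ω) - u x| ≤ ε / 2 + (ε / 2)⁻¹ * |u (𝒳.X t ω) - u x| ^ 2 := by
          rw [← sub_nonneg]
          have : ε / 2 + (ε / 2)⁻¹ * |u (𝒳.X t ω) - u x| ^ 2 - |u (𝒳.X t ω) - u x|
              = (ε / 2)⁻¹ * ((|u (𝒳.X t ω) - u x| - ε / 4) ^ 2 + 3 * (ε / 4) ^ 2) := by
            field_simp
            ring
          rw [this]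
          positivity
        rw [sq_abs] at h3
        refine h3.trans_eq ?_
        ring
    _ = ε / 2 + (ε / 2)⁻¹ * ((semigroup 𝒳.laws t (u * u) x - (u * u) x)
          - 2 * u x * (semigroup 𝒳.laws t u x - u x)) := by
        rw [integral_add j3 (integrable_const _), integral_add j1 j2, integral_const_mul,
          integral_const_mul, 𝒳.semigroup_laws hm, 𝒳.semigroup_laws (hC.measurable _ huu)]
        simp only [integral_const, probReal_univ, one_smul, Pi.mul_apply]
        ring
    _ ≤ ε / 2 + (ε / 2)⁻¹ * ((ε / 2) ^ 2 / (1 + 2 * |K|) * (1 + 2 * |K|)) := by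
        gcongr
        refine (le_abs_self _).trans ((abs_sub _ _).trans ?_)
        rw [abs_mul, abs_mul, abs_two, mul_add, mul_one]
        refine add_le_add h2 ?_
        rw [mul_comm]
        exact mul_le_mul h1 (by linarith [hK x, le_abs_self K]) (by positivity) hδ.le
    _ = ε := by field_simp; ring

/-- Differentiation of the Feynman-Kac factor at time `0`. -/
theorem tendstoUniformly_feynmanKac {H u : E → ℝ} (hH : H ∈ C) (hu : u ∈ C) (huu : u * u ∈ C) :
    TendstoUniformly (fun (t : ℝ≥0) x =>
      (∫ ω, (Real.exp (-𝒳.additiveFunctional H t ω) - 1) * u (𝒳.X t ω) ∂(𝒳.P x)) / t)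
      (-(H * u)) (𝓝[>] (0 : ℝ≥0)) := by
  have := 𝒳.isMarkovKernel
  obtain ⟨K₀, hK₀⟩ := hC.bounded H hH
  obtain ⟨U₀, hU₀⟩ := hC.bounded u hu
  obtain ⟨K, hKpos, hK⟩ : ∃ K : ℝ, 0 < K ∧ ∀ x, |H x| ≤ K :=
    ⟨|K₀| + 1, by positivity, fun x => by linarith [hK₀ x, le_abs_self K₀]⟩
  obtain ⟨U, hUpos, hU⟩ : ∃ U : ℝ, 0 < U ∧ ∀ x, |u x| ≤ U :=
    ⟨|U₀| + 1, by positivity, fun x => by linarith [hU₀ x, le_abs_self U₀]⟩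
  refine Metric.tendstoUniformly_iff.2 fun ε hε => ?_
  -- The first bound on `t` gives $|I|\le1$ for the exponential estimate; the second makes the
  -- quadratic error at most $(\varepsilon/4)t$.
  have hsmall : ∀ᶠ t : ℝ≥0 in 𝓝[>] (0 : ℝ≥0), (t : ℝ) < min (1 / K) (ε / 4 / (K ^ 2 * U)) := by
    have : Tendsto (fun t : ℝ≥0 => (t : ℝ)) (𝓝[>] 0) (𝓝 0) := by
      simpa using (NNReal.continuous_coe.tendsto 0).mono_left nhdsWithin_le_nhds
    exact this.eventually (gt_mem_nhds (by positivity))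
  filter_upwards [hsmall, eventually_mem_nhdsWithin,
    eventually_integral_abs_sub_le hC hu huu (show 0 < ε / 4 / K by positivity),
    eventually_abs_integral_additiveFunctional_sub_le hC hH (show 0 < ε / 4 / U by positivity)]
    with t hts ht0 h1 h2 x
  replace h1 := h1 x
  replace h2 := h2 x
  have htpos : (0 : ℝ) < t := NNReal.coe_pos.2 ht0
  have ht1 : K * t ≤ 1 := by
    have := (hts.trans_le (min_le_left _ _)).le
    rw [le_div_iff₀ hKpos] at this
    linarith
  have ht2 : K ^ 2 * U * t ≤ ε / 4 := by
    have := (hts.trans_le (min_le_right _ _)).le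
    rw [le_div_iff₀ (by positivity)] at this
    linarith
  let I : Ω → ℝ := 𝒳.additiveFunctional H t
  have hI : Measurable I := 𝒳.measurable_additiveFunctional (hC.measurable H hH) t
  have hIb : ∀ ω, |I ω| ≤ K * t := 𝒳.abs_additiveFunctional_le hK t
  have hux : Measurable fun ω => u (𝒳.X t ω) := (hC.measurable u hu).comp (𝒳.measurable_X t)
  have hexp : ∀ ω, |Real.exp (-I ω) - 1 + I ω| ≤ (K * t) ^ 2 := fun ω => by
    have := Real.abs_exp_sub_one_sub_id_le (x := -I ω) (by rw [abs_neg]; exact (hIb ω).trans ht1)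
    rw [sub_neg_eq_add, neg_sq] at this
    refine this.trans ?_
    rw [← sq_abs]
    exact pow_le_pow_left₀ (abs_nonneg _) (hIb ω) 2
  have i1 : Integrable (fun ω => (Real.exp (-I ω) - 1 + I ω) * u (𝒳.X t ω)) (𝒳.P x) :=
    Integrable.of_bound ((((Real.measurable_exp.comp hI.neg).sub measurable_const).add hI).mul
      hux).aestronglyMeasurable ((K * t) ^ 2 * U) (ae_of_all _ fun ω => by
        rw [Real.norm_eq_abs, abs_mul]
        exact mul_le_mul (hexp ω) (hU _) (abs_nonneg _) (by positivity))
  have iu : Integrable (fun ω => u (𝒳.X t ω) - u x) (𝒳.P x) :=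
    (𝒳.integrable_comp_X (hC.measurable u hu) hU t x).sub (integrable_const _)
  have i2 : Integrable (fun ω => I ω * (u (𝒳.X t ω) - u x)) (𝒳.P x) :=
    iu.bdd_mul hI.aestronglyMeasurable (ae_of_all _ hIb)
  have i3 : Integrable (fun ω => I ω - t * H x) (𝒳.P x) :=
    (Integrable.of_bound hI.aestronglyMeasurable (K * t) (ae_of_all _ hIb)).sub
      (integrable_const _)
  -- Linearize the exponential, then freeze $u(X_t)$ at $u(x)$ and $I$ at $tH(x)$. Each of the three
  -- errors is at most $(\varepsilon/4)t$; the last term is $t$ times the claimed limit.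
  have hdecomp : ∫ ω, (Real.exp (-I ω) - 1) * u (𝒳.X t ω) ∂(𝒳.P x)
      = ∫ ω, (Real.exp (-I ω) - 1 + I ω) * u (𝒳.X t ω) ∂(𝒳.P x)
        - ∫ ω, I ω * (u (𝒳.X t ω) - u x) ∂(𝒳.P x)
        - u x * ∫ ω, (I ω - t * H x) ∂(𝒳.P x) - t * H x * u x := by
    have i12 : Integrable (fun ω => (Real.exp (-I ω) - 1 + I ω) * u (𝒳.X t ω)
      - I ω * (u (𝒳.X t ω) - u x)) (𝒳.P x) := i1.sub i2
    have i123 : Integrable (fun ω => (Real.exp (-I ω) - 1 + I ω) * u (𝒳.X t ω)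
      - I ω * (u (𝒳.X t ω) - u x) - u x * (I ω - t * H x)) (𝒳.P x) := i12.sub (i3.const_mul _)
    have hconst : t * H x * u x = ∫ _, t * H x * u x ∂(𝒳.P x) := by simp
    rw [← integral_const_mul, ← integral_sub i1 i2, ← integral_sub i12 (i3.const_mul _), hconst,
      ← integral_sub i123 (integrable_const _)]
    refine integral_congr_ae (ae_of_all _ fun ω => ?_)
    simp only
    ring
  have b1 : |∫ ω, (Real.exp (-I ω) - 1 + I ω) * u (𝒳.X t ω) ∂(𝒳.P x)| ≤ ε / 4 * t := by
    have := norm_integral_le_of_norm_le_const (μ := 𝒳.P x)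
      (f := fun ω => (Real.exp (-I ω) - 1 + I ω) * u (𝒳.X t ω)) (C := (K * t) ^ 2 * U)
      (ae_of_all _ fun ω => by
        rw [Real.norm_eq_abs, abs_mul]
        exact mul_le_mul (hexp ω) (hU _) (abs_nonneg _) (by positivity))
    rw [probReal_univ, mul_one, Real.norm_eq_abs] at this
    refine this.trans ?_
    calc (K * t) ^ 2 * U = K ^ 2 * U * t * t := by ring
      _ ≤ ε / 4 * t := by gcongr
  have b2 : |∫ ω, I ω * (u (𝒳.X t ω) - u x) ∂(𝒳.P x)| ≤ ε / 4 * t := by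
    calc |∫ ω, I ω * (u (𝒳.X t ω) - u x) ∂(𝒳.P x)|
        ≤ ∫ ω, |I ω * (u (𝒳.X t ω) - u x)| ∂(𝒳.P x) := abs_integral_le_integral_abs
      _ ≤ ∫ ω, K * t * |u (𝒳.X t ω) - u x| ∂(𝒳.P x) := by
          refine integral_mono i2.abs (iu.abs.const_mul _) fun ω => ?_
          simp only [abs_mul]
          gcongr
          exact hIb ω
      _ = K * t * ∫ ω, |u (𝒳.X t ω) - u x| ∂(𝒳.P x) := integral_const_mul _ _
      _ ≤ K * t * (ε / 4 / K) := by gcongr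
      _ = ε / 4 * t := by field_simp
  have b3 : |u x * ∫ ω, (I ω - t * H x) ∂(𝒳.P x)| ≤ ε / 4 * t := by
    rw [abs_mul]
    calc |u x| * |∫ ω, (I ω - t * H x) ∂(𝒳.P x)| ≤ U * (ε / 4 / U * t) := by
          gcongr
          exact hU x
      _ = ε / 4 * t := by field_simp
  have hgoal : ∫ ω, (Real.exp (-𝒳.additiveFunctional H t ω) - 1) * u (𝒳.X t ω) ∂(𝒳.P x)
      = ∫ ω, (Real.exp (-I ω) - 1) * u (𝒳.X t ω) ∂(𝒳.P x) := rfl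
  rw [dist_comm, Real.dist_eq, hgoal, hdecomp, Pi.neg_apply, Pi.mul_apply]
  set A₁ := ∫ ω, (Real.exp (-I ω) - 1 + I ω) * u (𝒳.X t ω) ∂(𝒳.P x)
  set A₂ := ∫ ω, I ω * (u (𝒳.X t ω) - u x) ∂(𝒳.P x)
  set A₃ := u x * ∫ ω, (I ω - t * H x) ∂(𝒳.P x)
  have he : (A₁ - A₂ - A₃ - t * H x * u x) / t - -(H x * u x) = (A₁ - A₂ - A₃) / t := by
    field_simp
    ring
  rw [he, abs_div, abs_of_pos htpos, div_lt_iff₀ htpos]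
  have hb : |A₁ - A₂ - A₃| ≤ 3 * (ε / 4 * t) := by
    rw [abs_le] at b1 b2 b3 ⊢
    constructor <;> linarith [b1.1, b1.2, b2.1, b2.2, b3.1, b3.2]
  have : 0 < ε * t := by positivity
  linarith

end MarkovFamily

/-! ### The generator of the tilted process. -/

theorem tendstoUniformly_bounded_mul {ι E : Type*} {p : Filter ι} {Φ : ι → E → ℝ} {l b : E → ℝ}
    (h : TendstoUniformly Φ l p) {K : ℝ} (hb : ∀ x, |b x| ≤ K) :
    TendstoUniformly (fun i => b * Φ i) (b * l) p := by
  refine Metric.tendstoUniformly_iff.2 fun ε hε => ?_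
  have hpos : 0 < |K| + 1 := by positivity
  filter_upwards [Metric.tendstoUniformly_iff.1 h (ε / (|K| + 1)) (by positivity)] with i hi x
  have h1 := hi x
  rw [Real.dist_eq, lt_div_iff₀ hpos] at h1
  rw [Pi.mul_apply, Pi.mul_apply, Real.dist_eq, ← mul_sub, abs_mul, mul_comm]
  refine lt_of_le_of_lt (mul_le_mul_of_nonneg_left ?_ (abs_nonneg _)) h1
  linarith [hb x, le_abs_self K]

namespace MarkovFamily

variable {E Ω : Type*} [MeasurableSpace E] [MeasurableSpace Ω] (𝒳 : MarkovFamily E Ω)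

theorem tiltMartingale_eq (F : E → ℝ) (t : ℝ≥0) (ω : Ω) :
    𝒳.tiltMartingale F t ω = Real.exp (F (𝒳.X 0 ω) / 2) * (Real.exp (-F (𝒳.X t ω) / 2)
      * Real.exp (-𝒳.additiveFunctional (𝒳.logTransform F) t ω)) := by
  rw [← Real.exp_add, ← Real.exp_add, tiltMartingale, additiveFunctional]
  congr 1
  ring

theorem semigroup_tiltedLaws {F f : E → ℝ} (hF : Measurable F)
    (hH : Measurable (𝒳.logTransform F)) (hf : Measurable f) (t : ℝ≥0) (x : E) :
    semigroup (𝒳.tiltedLaws F) t f x = Real.exp (F x / 2) *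
      ∫ ω, Real.exp (-𝒳.additiveFunctional (𝒳.logTransform F) t ω)
        * (Real.exp (-F (𝒳.X t ω) / 2) * f (𝒳.X t ω)) ∂(𝒳.P x) := by
  have hM : Measurable (𝒳.tiltMartingale F t) := by
    rw [funext (𝒳.tiltMartingale_eq F t)]
    have h1 := hF.comp (𝒳.measurable_X 0)
    have h2 := hF.comp (𝒳.measurable_X t)
    exact (Real.measurable_exp.comp (h1.div_const 2)).mul
      ((Real.measurable_exp.comp (h2.neg.div_const 2)).mul
        (Real.measurable_exp.comp (𝒳.measurable_additiveFunctional hH t).neg))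
  rw [semigroup, tiltedLaws, Measure.dirac_bind 𝒳.measurable_P,
    integral_map (𝒳.measurable_path t).aemeasurable
      (f := fun γ => f (γ ⟨t, Set.mem_Iic.2 le_rfl⟩))
      (hf.comp (measurable_pi_apply _)).aestronglyMeasurable,
    integral_withDensity_eq_integral_toReal_smul hM.ennreal_ofReal
      (ae_of_all _ fun ω => ENNReal.ofReal_lt_top), ← integral_const_mul]
  refine integral_congr_ae ?_
  filter_upwards [𝒳.start x] with ω hω
  rw [ENNReal.toReal_ofReal (show 0 ≤ 𝒳.tiltMartingale F t ω from (Real.exp_pos _).le),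
    tiltMartingale_eq, hω, smul_eq_mul, path]
  ring

variable {𝒳} {C : Submodule ℝ (E → ℝ)} (hC : IsSemigroupSpace C 𝒳.laws)

include hC

/-- Writing $e^{-I}=1+(e^{-I}-1)$ separates the conjugated semigroup of $X$ from the Feynman-Kac
perturbation. -/
theorem differenceQuotient_tiltedLaws {F f : E → ℝ} (hF : Measurable F)
    (hH : 𝒳.logTransform F ∈ C) (hf : Measurable f)
    (hu : (fun y => Real.exp (-F y / 2)) * f ∈ C) (t : ℝ≥0) (x : E) :
    differenceQuotient (𝒳.tiltedLaws F) f t x = Real.exp (F x / 2) *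
      (differenceQuotient 𝒳.laws ((fun y => Real.exp (-F y / 2)) * f) t x
        + (∫ ω, (Real.exp (-𝒳.additiveFunctional (𝒳.logTransform F) t ω) - 1)
          * ((fun y => Real.exp (-F y / 2)) * f) (𝒳.X t ω) ∂(𝒳.P x)) / t) := by
  have := 𝒳.isMarkovKernel
  obtain ⟨K, hK⟩ := hC.bounded _ hH
  obtain ⟨U, hU⟩ := hC.bounded _ hu
  set u := (fun y => Real.exp (-F y / 2)) * f with hudef
  have hHm := hC.measurable _ hH
  have hum := hC.measurable _ hu
  have i1 := 𝒳.integrable_comp_X hum hU t x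
  have i2 : Integrable (fun ω => Real.exp (-𝒳.additiveFunctional (𝒳.logTransform F) t ω)
      * u (𝒳.X t ω)) (𝒳.P x) := by
    refine i1.bdd_mul (c := Real.exp (K * t)) (Real.measurable_exp.comp
      (𝒳.measurable_additiveFunctional hHm t).neg).aestronglyMeasurable (ae_of_all _ fun ω => ?_)
    rw [Real.norm_eq_abs, Real.abs_exp]
    exact Real.exp_le_exp.2 ((neg_le_abs _).trans (𝒳.abs_additiveFunctional_le hK t ω))
  have h1 : ∫ ω, (Real.exp (-𝒳.additiveFunctional (𝒳.logTransform F) t ω) - 1)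
      * u (𝒳.X t ω) ∂(𝒳.P x)
      = ∫ ω, Real.exp (-𝒳.additiveFunctional (𝒳.logTransform F) t ω) * u (𝒳.X t ω) ∂(𝒳.P x)
        - semigroup 𝒳.laws t u x := by
    rw [𝒳.semigroup_laws hum, ← integral_sub i2 i1]
    refine integral_congr_ae (ae_of_all _ fun ω => ?_)
    simp only
    ring
  have hfx : f x = Real.exp (F x / 2) * u x := by
    rw [hudef, Pi.mul_apply, ← mul_assoc, ← Real.exp_add, ← add_div, add_neg_cancel, zero_div,
      Real.exp_zero, one_mul]
  rw [differenceQuotient, differenceQuotient, h1, 𝒳.semigroup_tiltedLaws hF hHm hf, hfx]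
  simp only [hudef, Pi.mul_apply]
  ring

theorem generator_tiltedLaws {F : E → ℝ}
    (hF : (fun x => Real.exp (-F x / 2)) ∈ generatorDomain C 𝒳.laws)
    (hFb : ∃ K : ℝ, ∀ x, |F x| ≤ K)
    (hmul : ∀ f ∈ generatorDomain C 𝒳.laws, ∀ g ∈ generatorDomain C 𝒳.laws,
      f * g ∈ generatorDomain C 𝒳.laws) (hFm : Measurable F) :
    generatorDomain C (𝒳.tiltedLaws F) = generatorDomain C 𝒳.laws ∧
      ∀ φ ∈ generatorDomain C 𝒳.laws, ∀ x, generator (𝒳.tiltedLaws F) φ x =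
        Real.exp (F x / 2) * generator 𝒳.laws (fun y => Real.exp (-F y / 2) * φ y) x
          - Real.exp (F x / 2) * φ x * generator 𝒳.laws (fun y => Real.exp (-F y / 2)) x := by
  obtain ⟨K, hK⟩ := hFb
  have hCmul : ∀ f ∈ C, ∀ g ∈ C, f * g ∈ C := fun f hf g hg =>
    mul_mem_of_generatorDomain hC hmul hf hg
  set g : E → ℝ := fun x => Real.exp (-F x / 2) with hg
  set gi : E → ℝ := fun x => Real.exp (F x / 2) with hgi
  have hginv : (fun x => (g x)⁻¹) = gi := funext fun x => by
    simp only [hg, hgi]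
    rw [← Real.exp_neg]
    congr 1
    ring
  have hgid : gi ∈ generatorDomain C 𝒳.laws := by
    rw [← hginv]
    refine inv_mem_generatorDomain hC hmul hF (c := Real.exp (-|K| / 2))
      (c' := Real.exp (|K| / 2 + 1)) (Real.exp_pos _) (Real.exp_lt_exp.2 ?_) fun x => ⟨?_, ?_⟩
    · linarith [abs_nonneg K]
    · exact Real.exp_le_exp.2 (by linarith [le_abs_self (F x), hK x, le_abs_self K])
    · exact Real.exp_le_exp.2 (by linarith [neg_le_abs (F x), hK x, le_abs_self K])
  have hgig : gi * g = 1 := funext fun x => by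
    simp only [hg, hgi, Pi.mul_apply, Pi.one_apply]
    rw [← Real.exp_add, ← add_div, add_neg_cancel, zero_div, Real.exp_zero]
  obtain ⟨Kg, hKg⟩ := hC.bounded g hF.1
  obtain ⟨Ki, hKi⟩ := hC.bounded gi hgid.1
  set H := 𝒳.logTransform F with hHdef
  have hHeq : H = gi * generator 𝒳.laws g := rfl
  have hH : H ∈ C := by rw [hHeq]; exact hCmul _ hgid.1 _ hF.2.1
  let FK : (E → ℝ) → ℝ≥0 → E → ℝ := fun u t x =>
    (∫ ω, (Real.exp (-𝒳.additiveFunctional H t ω) - 1) * u (𝒳.X t ω) ∂(𝒳.P x)) / t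
  have hFK : ∀ u ∈ C, TendstoUniformly (FK u) (-(H * u)) (𝓝[>] (0 : ℝ≥0)) := fun u hu =>
    tendstoUniformly_feynmanKac hC hH hu (hCmul u hu u hu)
  have hdq : ∀ f ∈ C, ∀ t, differenceQuotient (𝒳.tiltedLaws F) f t
      = gi * (differenceQuotient 𝒳.laws (g * f) t + FK (g * f) t) := fun f hf t =>
    funext fun x => differenceQuotient_tiltedLaws hC hFm hH (hC.measurable f hf)
      (hCmul _ hF.1 _ hf) t x
  have hforward : ∀ φ ∈ generatorDomain C 𝒳.laws,
      TendstoUniformly (differenceQuotient (𝒳.tiltedLaws F) φ)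
        (gi * (generator 𝒳.laws (g * φ) + -(H * (g * φ)))) (𝓝[>] (0 : ℝ≥0)) := by
    intro φ hφ
    have hu := hmul _ hF _ hφ
    rw [funext (hdq φ hφ.1)]
    exact tendstoUniformly_bounded_mul (hu.2.2.add (hFK _ hu.1)) hKi
  refine ⟨Set.Subset.antisymm (fun f hf => ?_) (fun φ hφ => ?_), fun φ hφ x => ?_⟩
  · have hu := hCmul _ hF.1 _ hf.1
    -- Since $g\,e^{F/2}=1$, the quotient identity can be solved for the quotient of $X$ at $gf$, so
    -- convergence for $X^F$ forces convergence for $X$.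
    have hinv : ∀ t, differenceQuotient 𝒳.laws (g * f) t
        = g * differenceQuotient (𝒳.tiltedLaws F) f t - FK (g * f) t := fun t => by
      rw [hdq f hf.1, ← mul_assoc, mul_comm g gi, hgig, one_mul, add_sub_cancel_right]
    have hud : g * f ∈ generatorDomain C 𝒳.laws := by
      refine mem_generatorDomain_of_tendstoUniformly hu
        (C.sub_mem (hCmul _ hF.1 _ hf.2.1) (C.neg_mem (hCmul _ hH _ hu))) ?_
      rw [funext hinv]
      exact (tendstoUniformly_bounded_mul hf.2.2 hKg).sub (hFK _ hu)
    have := hmul _ hgid _ hud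
    rwa [← mul_assoc, hgig, one_mul] at this
  · have hu := hmul _ hF _ hφ
    exact mem_generatorDomain_of_tendstoUniformly hφ.1
      (hCmul _ hgid.1 _ (C.add_mem hu.2.1 (C.neg_mem (hCmul _ hH _ hu.1)))) (hforward φ hφ)
  · rw [generator_eq_of_tendstoUniformly (hforward φ hφ)]
    have h1 : gi x * g x = 1 := congrFun hgig x
    have h2 : (fun y => Real.exp (-F y / 2) * φ y) = g * φ := rfl
    rw [h2]
    simp only [hHeq, Pi.mul_apply, Pi.add_apply, Pi.neg_apply]
    linear_combination (-(gi x * generator 𝒳.laws g x * φ x)) * h1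

end MarkovFamily

end FlemingSheu

end

theorem mainTheorem12 {E Ω : Type*} [MeasurableSpace E] [MeasurableSpace Ω]
    (𝒳 : FlemingSheu.MarkovFamily E Ω)
    (π : Measure E) [SigmaFinite π]
    (hrev : FlemingSheu.IsReversible 𝒳.laws π)
    (C : Submodule ℝ (E → ℝ)) (hC : FlemingSheu.IsSemigroupSpace C 𝒳.laws)
    (F : E → ℝ)
    (hF : (fun x => Real.exp (-F x / 2)) ∈ FlemingSheu.generatorDomain C 𝒳.laws)
    (hM : ∀ x, Martingale (𝒳.tiltMartingale F) 𝒳.filtration (𝒳.P x)) :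
    FlemingSheu.IsReversible (𝒳.tiltedLaws F)
        (π.withDensity (fun x => ENNReal.ofReal (Real.exp (-F x)))) ∧
      ((∃ K : ℝ, ∀ x, |F x| ≤ K) →
        (∀ f ∈ FlemingSheu.generatorDomain C 𝒳.laws,
          ∀ g ∈ FlemingSheu.generatorDomain C 𝒳.laws,
            f * g ∈ FlemingSheu.generatorDomain C 𝒳.laws) →
        FlemingSheu.generatorDomain C (𝒳.tiltedLaws F)
            = FlemingSheu.generatorDomain C 𝒳.laws ∧
          ∀ φ ∈ FlemingSheu.generatorDomain C 𝒳.laws, ∀ x,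
            FlemingSheu.generator (𝒳.tiltedLaws F) φ x =
              Real.exp (F x / 2)
                  * FlemingSheu.generator 𝒳.laws (fun y => Real.exp (-F y / 2) * φ y) x
                - Real.exp (F x / 2) * φ x
                  * FlemingSheu.generator 𝒳.laws (fun y => Real.exp (-F y / 2)) x) := by
  have hFm : Measurable F := by
    -- `F` inherits measurability from $e^{-F/2}\in C$ through the logarithm.
    have h : F = fun x => -2 * Real.log (Real.exp (-F x / 2)) := by
      funext x
      rw [Real.log_exp]
      ring
    rw [h]
    exact (Real.measurable_log.comp (hC.measurable _ hF.1)).const_mul (-2)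
  have hHm : Measurable (𝒳.logTransform F) :=
    (Real.measurable_exp.comp (hFm.div_const 2)).mul (hC.measurable _ hF.2.1)
  exact ⟨𝒳.isReversible_tiltedLaws π hrev hFm hHm, fun hFb hmul =>
    FlemingSheu.MarkovFamily.generator_tiltedLaws hC hF hFb hmul hFm⟩
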